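/- Let $\Phi$ be a finite irreducible reduced crystallographic root system spanning a Euclidean space $E$ of dimension $n$ whose scalar product $(\cdot,\cdot)$ is invariant under the Weyl group $W$. Let $\Pi$ be a basis of simple roots, let $\theta$ be the highest root, and let $\mathcal P_\Phi\subset E$ be the convex hull of $\Phi$. Let $\widehat\Phi=\{\alpha+k\delta\mid\alpha\in\Phi,\ k\in\mathbb Z\}\subset E\oplus\mathbb R\delta$ be the affine root system associated with $\Phi$, where $(\cdot,\cdot)$ is extended to $E\oplus\mathbb R\delta$ with kernel $\mathbb R\delta$, and put $\alpha_0=-\theta+\delta$. For $\Gamma\subseteq\Pi$ put $\widehat\Gamma=\Gamma\cup\{\alpha_0\}$ and $$\Gamma^*=\Gamma\cup(\widehat\Gamma^{\perp}\cap\Pi),$$ let $\widehat\Phi(\widehat\Gamma)$ be the root subsystem of $\widehat\Phi$ generated by $\widehat\Gamma$, and let $\mathcal I$ be the set of all $\Gamma\subseteq\Pi$ such that $\widehat\Phi(\widehat\Gamma)$ is irreducible, i.e. not a union of two nonempty mutually orthogonal subsets. For $S\subseteq\Pi$ let $W\langle S\rangle$ be the subgroup of $W$ generated by the reflections with respect to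 the roots in $S$. The $f$-polynomial $\sum_{d=0}^{n}f_d t^d$ of $\mathcal P_\Phi$, where $f_d$ is the number of $d$-dimensional nonempty faces of $\mathcal P_\Phi$ (with $\mathcal P_\Phi$ itself counted as a face), is $$\sum_{\Gamma\in\mathcal I}[W:W\langle\Gamma^*\rangle]\,t^{|\Gamma|}.$$ Moreover, for every $\Gamma\in\mathcal I$, the stabilizer in $W$ of the corresponding face $$\{x\in\mathcal P_\Phi\mid (x,\breve\omega_\alpha)=(\theta,\breve\omega_\alpha)\text{ for all }\alpha\in\Pi\setminus\Gamma\}$$ is $W\langle\Gamma^*\rangle$, where $(\breve\omega_\alpha)_{\alpha\in\Pi}$ is the basis of $E$ dual to $\Pi$. -/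

import Mathlib

open Polynomial

namespace RootPolytope

noncomputable section

/-! ### Faces and the f-polynomial of a polytope -/

section Polytope

variable {E : Type*} [NormedAddCommGroup E] [InnerProductSpace ℝ E]

/-- The nonempty faces of dimension `d` of the polytope `K`: the nonempty sets on which some
linear functional attains its maximum over `K` (the zero functional gives `K` itself), whose
affine hull has dimension `d`. -/
def facesOfDim (K : Set E) (d : ℕ) : Set (Set E) :=
  {F | F.Nonempty ∧ IsExposed ℝ K F ∧ Module.finrank ℝ (vectorSpan ℝ F) = d}

/-- The f-polynomial `∑_d f_d t^d`, with `f_d` the number of `d`-dimensional faces. The polytope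
itself is counted as a face, the empty set is not. -/
def fPolynomial (K : Set E) : ℕ[X] :=
  ∑ d ∈ Finset.range (Module.finrank ℝ E + 1), C (facesOfDim K d).ncard * X ^ d

end Polytope

/-! ### The affine root system

It lives in `E × ℝ`, where `(x, c)` stands for `x + c δ`. -/

section Affine

variable {E : Type*} [NormedAddCommGroup E] [InnerProductSpace ℝ E]

/-- The positive semidefinite form on `E ⊕ ℝδ` that extends the scalar product of `E` and has
`ℝδ` as its kernel. -/
def affineForm (x y : E × ℝ) : ℝ := inner ℝ x.1 y.1

/-- The reflection `s_a` on `E ⊕ ℝδ` with respect to a non-isotropic vector `a`, applied to `x`. -/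
def affineReflection (a x : E × ℝ) : E × ℝ :=
  x - (2 * affineForm x a / affineForm a a) • a

/-- A set of roots is irreducible if it is nonempty and is not the disjoint union of two nonempty
mutually orthogonal subsets. -/
def IsIrreducibleSubsystem (S : Set (E × ℝ)) : Prop :=
  S.Nonempty ∧ ∀ A B : Set (E × ℝ), A ∪ B = S → Disjoint A B → A.Nonempty → B.Nonempty →
    ∃ a ∈ A, ∃ c ∈ B, affineForm a c ≠ 0

end Affine

section RootSystem

variable {ι E N : Type*} [NormedAddCommGroup E] [InnerProductSpace ℝ E]
  [AddCommGroup N] [Module ℝ N]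

/-- The affine root system `{α + k δ | α ∈ Φ, k ∈ ℤ}` associated with `Φ`. -/
def affineRoots (P : RootPairing ι ℝ E N) : Set (E × ℝ) :=
  {x | ∃ (i : ι) (k : ℤ), x = (P.root i, (k : ℝ))}

/-- The root subsystem of the affine root system generated by a set `S` of affine roots: the
smallest set of affine roots that contains `S` and is stable under the reflections with respect to
its own elements. -/
def generatedSubsystem (P : RootPairing ι ℝ E N) (S : Set (E × ℝ)) : Set (E × ℝ) :=
  ⋂₀ {T | S ⊆ T ∧ T ⊆ affineRoots P ∧ ∀ a ∈ T, ∀ x ∈ T, affineReflection a x ∈ T}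

/-- The root polytope: the convex hull of all the roots. -/
def rootPolytope (P : RootPairing ι ℝ E N) : Set E :=
  convexHull ℝ (Set.range P.root)

variable {P : RootPairing ι ℝ E N}

/-- `θ` is (the index of) the highest root with respect to the simple roots of `b`: no root has
greater height. -/
def IsHighestRoot (b : P.Base) (θ : ι) : Prop := ∀ i, b.height i ≤ b.height θ

/-- For a set `Γ` of simple roots, the set `Γ ∪ {α₀}` with `α₀ = -θ + δ`. -/
def extended (P : RootPairing ι ℝ E N) (θ : ι) (Γ : Finset ι) : Set (E × ℝ) :=
  insert (-P.root θ, 1) ((fun i => (P.root i, 0)) '' (Γ : Set ι))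

open Classical in
/-- The family of all sets `Γ` of simple roots such that the subsystem of the affine root system
generated by `Γ ∪ {α₀}` is irreducible. -/
def irreducibleFamily (b : P.Base) (θ : ι) : Finset (Finset ι) :=
  b.support.powerset.filter fun Γ =>
    IsIrreducibleSubsystem (generatedSubsystem P (extended P θ Γ))

/-- `Γ* = Γ ∪ ((Γ ∪ {α₀})^⊥ ∩ Π)`, as a set of indices of simple roots. -/
def gammaStar (b : P.Base) (θ : ι) (Γ : Finset ι) : Set ι :=
  ↑Γ ∪ {i | i ∈ b.support ∧ ∀ γ ∈ extended P θ Γ, affineForm γ (P.root i, 0) = 0}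

/-- `W⟨S⟩`, the subgroup of the Weyl group generated by the reflections with respect to the roots
with index in `S`. -/
def parabolicSubgroup (P : RootPairing ι ℝ E N) (S : Set ι) : Subgroup P.weylGroup :=
  Subgroup.closure (RootPairing.weylGroup.ofIdx P '' S)

/-- The standard parabolic face corresponding to a set `Γ` of simple roots: the points `x` of the
root polytope such that `(x, ω̌_α) = (θ, ω̌_α)` for all simple roots `α` outside `Γ`. Here
`(x, ω̌_α)` is the coordinate of `x` at `α` in the basis of simple roots. -/
def standardFace [P.IsRootSystem] (b : P.Base) (θ : ι) (Γ : Finset ι) : Set E :=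
  {x | x ∈ rootPolytope P ∧ ∀ i : b.support, (i : ι) ∉ Γ →
    b.toWeightBasis.repr x i = b.toWeightBasis.repr (P.root θ) i}

end RootSystem

end

end RootPolytope

-- A face of the polytope is the maximum locus of some vector, and the Weyl group can move that
-- vector into the dominant chamber (`IsInvariant.exists_isDominant_smul`). Every root is
-- coordinatewise at most `θ` (`IsHighestRoot.coord_le`), so a dominant functional is maximal
-- exactly where all coordinates on which it is positive agree with those of `θ`. Hence every face
-- is a Weyl translate of a standard face (`IsHighestRoot.maximizers_eq_standardFace`).
--
-- Different `Γ` can define the same standard face: components of `Γ` orthogonal to `θ` contribute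
-- nothing (`IsHighestRoot.standardFace_sdiff`). Removing them leaves a linked set, and linked sets
-- are exactly the members of the irreducible family (`IsInvariant.mem_irreducibleFamily`), with
-- `α₀` playing the part of `θ`.
--
-- For linked `Γ` the face has direction space `span Γ`, hence dimension `|Γ|`. The sum of its roots
-- is a dominant vector orthogonal to precisely the simple roots in `Γ*`
-- (`IsHighestRoot.zeros_rootSum`). Since the chamber is a fundamental domain and stabilizers of
-- dominant vectors are parabolic (`IsInvariant.smul_dominant`), the stabilizer of the face is
-- `W⟨Γ*⟩` and distinct linked sets give distinct orbits. Orbit-stabilizer then counts the faces.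

namespace RootPolytope

-- Invariant scalar product and the action of the Weyl group

section WeylGroup

variable {ι E N : Type*} [NormedAddCommGroup E] [InnerProductSpace ℝ E]
  [AddCommGroup N] [Module ℝ N] {P : RootPairing ι ℝ E N}

/-- The inner product is invariant under the reflections of the root pairing. -/
def IsInvariant (P : RootPairing ι ℝ E N) : Prop :=
  ∀ (i : ι) (x y : E), inner ℝ (P.reflection i x) (P.reflection i y) = inner ℝ x y

theorem inner_root_self_pos (i : ι) : 0 < inner ℝ (P.root i) (P.root i) :=
  real_inner_self_pos.2 (P.ne_zero i)

/-- Invariance under `s_i` applied to `x` and `α_i`, with `s_i α_i = -α_i`; this ties the abstract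
coroot to the scalar product. -/
theorem IsInvariant.coroot'_mul (h : IsInvariant P) (i : ι) (x : E) :
    P.coroot' i x * inner ℝ (P.root i) (P.root i) = 2 * inner ℝ x (P.root i) := by
  have := h i x (P.root i)
  rw [P.reflection_apply_self, P.reflection_apply, inner_neg_right, inner_sub_left,
    real_inner_smul_left] at this
  linarith

theorem IsInvariant.coroot'_eq (h : IsInvariant P) (i : ι) (x : E) :
    P.coroot' i x = 2 * inner ℝ x (P.root i) / inner ℝ (P.root i) (P.root i) := by
  rw [eq_div_iff (inner_root_self_pos i).ne', h.coroot'_mul]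

theorem IsInvariant.reflection_eq (h : IsInvariant P) (i : ι) (x : E) :
    P.reflection i x =
      x - (2 * inner ℝ x (P.root i) / inner ℝ (P.root i) (P.root i)) • P.root i := by
  rw [P.reflection_apply, h.coroot'_eq]

theorem IsInvariant.reflection_eq_self (h : IsInvariant P) {i : ι} {x : E}
    (hx : inner ℝ x (P.root i) = 0) : P.reflection i x = x := by
  simp [h.reflection_eq, hx]

theorem IsInvariant.inner_smul_smul (h : IsInvariant P) (w : P.weylGroup) (x y : E) :
    inner ℝ (w • x) (w • y) = inner ℝ x y := by
  revert x y
  obtain ⟨g, hg⟩ := w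
  induction hg using RootPairing.weylGroup.induction with
  | mem i => exact h i
  | one => intro x y; rfl
  | mul g₁ g₂ hg₁ hg₂ hg₁' hg₂' =>
    intro x y
    rw [← Submonoid.mk_mul_mk _ _ _ hg₁ hg₂, mul_smul, mul_smul, hg₁', hg₂']

theorem weylGroup_ext {v w : P.weylGroup} (h : ∀ x : E, v • x = w • x) : v = w :=
  Subtype.ext <| RootPairing.Equiv.weightHom_injective P <| LinearEquiv.ext h

theorem root_smul (w : P.weylGroup) (i : ι) : P.root (w • i) = w • P.root i :=
  (P.weylGroup_apply_root w i).symm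

theorem ofIdx_smul_vector (i : ι) (x : E) :
    RootPairing.weylGroup.ofIdx P i • x = P.reflection i x := rfl

theorem ofIdx_smul_index (i j : ι) :
    RootPairing.weylGroup.ofIdx P i • j = P.reflectionPerm i j := by
  apply P.root.injective
  rw [root_smul, ofIdx_smul_vector, P.root_reflectionPerm]

theorem ofIdx_mul_self (i : ι) :
    RootPairing.weylGroup.ofIdx P i * RootPairing.weylGroup.ofIdx P i = 1 := by
  refine weylGroup_ext fun x => ?_
  rw [mul_smul, ofIdx_smul_vector, ofIdx_smul_vector, one_smul]
  exact P.reflection_same i x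

theorem weylGroup_smul_sub (w : P.weylGroup) (x y : E) : w • (x - y) = w • x - w • y :=
  smul_sub w x y

theorem weylGroup_smul_smul (w : P.weylGroup) (c : ℝ) (x : E) : w • (c • x) = c • (w • x) :=
  map_smul (RootPairing.Equiv.weightHom P w) c x

theorem IsInvariant.mul_ofIdx (h : IsInvariant P) (w : P.weylGroup) (i : ι) :
    w * RootPairing.weylGroup.ofIdx P i = RootPairing.weylGroup.ofIdx P (w • i) * w := by
  refine weylGroup_ext fun x => ?_
  rw [mul_smul, mul_smul, ofIdx_smul_vector, ofIdx_smul_vector, h.reflection_eq, h.reflection_eq,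
    root_smul, h.inner_smul_smul, h.inner_smul_smul, weylGroup_smul_sub, weylGroup_smul_smul]

theorem ofIdx_reflectionPerm (i j : ι) :
    RootPairing.weylGroup.ofIdx P (P.reflectionPerm j i) =
      RootPairing.weylGroup.ofIdx P j * RootPairing.weylGroup.ofIdx P i *
        RootPairing.weylGroup.ofIdx P j := by
  refine weylGroup_ext fun x => ?_
  rw [mul_smul, mul_smul]
  simp only [ofIdx_smul_vector, RootPairing.reflection_reflectionPerm]
  rfl

variable [P.IsRootSystem]

/-- The action on the finite set of roots is faithful because the roots span. -/
theorem finite_weylGroup [Finite ι] : Finite P.weylGroup := by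
  refine Finite.of_injective (fun w : P.weylGroup => fun i : ι => w • i) fun v w hvw => ?_
  refine weylGroup_ext fun x => ?_
  have : (RootPairing.Equiv.weightHom P v : E →ₗ[ℝ] E) = RootPairing.Equiv.weightHom P w := by
    refine LinearMap.ext_on_range (RootPairing.IsRootSystem.span_root_eq_top (P := P)) fun i => ?_
    have := congrArg P.root (congrFun hvw i)
    rwa [root_smul, root_smul] at this
  exact LinearMap.congr_fun this x

-- Coordinates in the simple roots and dominant vectors

variable (b : P.Base)

theorem coord_eq_intCast {i : ι} {f : ι → ℤ} (hf : P.root i = ∑ j ∈ b.support, f j • P.root j)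
    (j : b.support) : b.toWeightBasis.repr (P.root i) j = f j := by
  have : P.root i = ∑ k : b.support, (f k : ℝ) • b.toWeightBasis k := by
    rw [hf, ← Finset.sum_coe_sort]
    simp [Int.cast_smul_eq_zsmul]
  rw [this, Module.Basis.repr_sum_self]

theorem sum_coord_root (i : ι) :
    ∑ j : b.support, b.toWeightBasis.repr (P.root i) j = b.height i := by
  obtain ⟨f, -, -, hf⟩ := b.exists_root_eq_sum_int i
  rw [RootPairing.Base.height_eq_sum hf]
  push_cast
  rw [← Finset.sum_coe_sort b.support]
  exact Finset.sum_congr rfl fun j _ => coord_eq_intCast b hf j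

theorem coord_nonneg_of_isPos {i : ι} (hi : b.IsPos i) (j : b.support) :
    0 ≤ b.toWeightBasis.repr (P.root i) j := by
  obtain ⟨f, -, h, hf⟩ := b.exists_root_eq_sum_int i
  rw [coord_eq_intCast b hf]
  rcases h with h | h
  · exact_mod_cast h.le j
  · rw [RootPairing.Base.isPos_iff, RootPairing.Base.height_eq_sum hf] at hi
    exact absurd hi (not_lt.2 (Finset.sum_nonpos fun k _ => h.le k))

theorem coord_nonpos_of_not_isPos {i : ι} (hi : ¬ b.IsPos i) (j : b.support) :
    b.toWeightBasis.repr (P.root i) j ≤ 0 := by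
  obtain ⟨f, -, h, hf⟩ := b.exists_root_eq_sum_int i
  rw [coord_eq_intCast b hf]
  rcases h with h | h
  · rw [RootPairing.Base.isPos_iff', RootPairing.Base.height_eq_sum hf] at hi
    exact absurd (Finset.sum_nonneg fun k _ => h.le k) hi
  · exact_mod_cast h.le j

theorem inner_eq_sum_coord (v x : E) :
    inner ℝ v x = ∑ j : b.support, b.toWeightBasis.repr x j * inner ℝ v (P.root j) := by
  conv_lhs => rw [← b.toWeightBasis.sum_repr x]
  simp [inner_sum, real_inner_smul_right]

open Classical in
theorem coord_simple (i j : b.support) :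
    b.toWeightBasis.repr (P.root i) j = if i = j then 1 else 0 := by
  rw [b.toWeightBasis_repr_root, Finsupp.single_apply]

open Classical in
theorem IsInvariant.coord_reflection (h : IsInvariant P) (i j : b.support) (x : E) :
    b.toWeightBasis.repr (P.reflection i x) j = b.toWeightBasis.repr x j -
      if i = j then 2 * inner ℝ x (P.root i) / inner ℝ (P.root i) (P.root i) else 0 := by
  rw [h.reflection_eq, map_sub, map_smul, Finsupp.sub_apply, Finsupp.smul_apply, coord_simple]
  simp

/-- A vector is dominant if its inner products with the simple roots are nonnegative. -/
def IsDominant (v : E) : Prop := ∀ i ∈ b.support, 0 ≤ inner ℝ v (P.root i)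

variable {b}

theorem IsDominant.inner_nonneg {v : E} (hv : IsDominant b v) {i : ι} (hi : b.IsPos i) :
    0 ≤ inner ℝ v (P.root i) := by
  rw [inner_eq_sum_coord b]
  exact Finset.sum_nonneg fun j _ => mul_nonneg (coord_nonneg_of_isPos b hi j) (hv j j.2)

theorem IsDominant.inner_nonpos {v : E} (hv : IsDominant b v) {i : ι} (hi : ¬ b.IsPos i) :
    inner ℝ v (P.root i) ≤ 0 := by
  rw [inner_eq_sum_coord b]
  exact Finset.sum_nonpos fun j _ =>
    mul_nonpos_of_nonpos_of_nonneg (coord_nonpos_of_not_isPos b hi j) (hv j j.2)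

/-- Take `w` maximizing the coordinate sum of `w • v`: a simple root with negative inner product
would let its reflection increase that sum. -/
theorem IsInvariant.exists_isDominant_smul [Finite ι] (h : IsInvariant P) (b : P.Base) (v : E) :
    ∃ w : P.weylGroup, IsDominant b (w • v) := by
  have := finite_weylGroup (P := P)
  obtain ⟨w, hw⟩ := Finite.exists_max
    fun w : P.weylGroup => ∑ j : b.support, b.toWeightBasis.repr (w • v) j
  refine ⟨w, fun i hi => ?_⟩
  have := hw (RootPairing.weylGroup.ofIdx P i * w)
  simp only [mul_smul, ofIdx_smul_vector] at this
  lift i to b.support using hi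
  simp only [h.coord_reflection, Finset.sum_sub_distrib, Finset.sum_ite_eq, Finset.mem_univ,
    if_true] at this
  by_contra! hlt
  have : 2 * inner ℝ (w • v) (P.root i) / inner ℝ (P.root i) (P.root i) < 0 :=
    div_neg_of_neg_of_pos (by linarith) (inner_root_self_pos _)
  linarith

-- Words in simple reflections and the fundamental chamber

variable [Finite ι] [P.IsCrystallographic] [P.IsReduced]

omit [P.IsRootSystem] in
theorem ofIdx_mem_closure_support (b : P.Base) (i : ι) :
    RootPairing.weylGroup.ofIdx P i ∈ parabolicSubgroup P (b.support : Set ι) := by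
  refine b.induction_reflect i (fun i hi => ?_)
    (fun i hi => Subgroup.subset_closure (Set.mem_image_of_mem _ hi)) (fun i j hi hj => ?_)
  · rw [ofIdx_reflectionPerm]
    exact mul_mem (mul_mem hi hi) hi
  · have hj' : RootPairing.weylGroup.ofIdx P j ∈ parabolicSubgroup P (b.support : Set ι) :=
      Subgroup.subset_closure ⟨j, hj, rfl⟩
    rw [ofIdx_reflectionPerm]
    exact mul_mem (mul_mem hj' hi) hj'

/-- The product of the reflections in a list of roots. -/
noncomputable def wordProd (P : RootPairing ι ℝ E N) (l : List ι) : P.weylGroup :=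
  (l.map (RootPairing.weylGroup.ofIdx P)).prod

omit [P.IsRootSystem] [Finite ι] [P.IsCrystallographic] [P.IsReduced] in
@[simp] theorem wordProd_nil : wordProd P [] = 1 := rfl

omit [P.IsRootSystem] [Finite ι] [P.IsCrystallographic] [P.IsReduced] in
@[simp] theorem wordProd_cons (i : ι) (l : List ι) :
    wordProd P (i :: l) = RootPairing.weylGroup.ofIdx P i * wordProd P l := by
  simp [wordProd]

omit [P.IsRootSystem] [Finite ι] [P.IsCrystallographic] [P.IsReduced] in
@[simp] theorem wordProd_append (l l' : List ι) :
    wordProd P (l ++ l') = wordProd P l * wordProd P l' := by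
  simp [wordProd]

omit [P.IsRootSystem] [Finite ι] [P.IsCrystallographic] [P.IsReduced] in
theorem exists_wordProd_eq_of_mem (b : P.Base) {w : P.weylGroup}
    (hw : w ∈ parabolicSubgroup P (b.support : Set ι)) :
    ∃ l : List ι, (∀ i ∈ l, i ∈ b.support) ∧ wordProd P l = w := by
  induction hw using Subgroup.closure_induction with
  | mem x hx =>
    obtain ⟨j, hj, rfl⟩ := hx
    exact ⟨[j], by simpa using hj, by simp⟩
  | one => exact ⟨[], by simp, rfl⟩
  | mul x y _ _ hx hy =>
    obtain ⟨l, hl, rfl⟩ := hx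
    obtain ⟨l', hl', rfl⟩ := hy
    refine ⟨l ++ l', fun i hi => ?_, by simp⟩
    rcases List.mem_append.1 hi with hi | hi
    exacts [hl i hi, hl' i hi]
  | inv x hxm hx =>
    obtain ⟨l, hl, rfl⟩ := hx
    refine ⟨l.reverse, by simpa using hl, ?_⟩
    rw [eq_inv_iff_mul_eq_one]
    clear hl hxm
    induction l with
    | nil => simp
    | cons i l ih =>
      rw [List.reverse_cons, wordProd_append, wordProd_cons, wordProd_cons, wordProd_nil, mul_one,
        mul_assoc, ← mul_assoc (RootPairing.weylGroup.ofIdx P i), ofIdx_mul_self, one_mul, ih]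

omit [P.IsRootSystem] in
theorem exists_wordProd_eq (b : P.Base) (w : P.weylGroup) :
    ∃ l : List ι, (∀ i ∈ l, i ∈ b.support) ∧ wordProd P l = w := by
  obtain ⟨g, hg⟩ := w
  induction hg using RootPairing.weylGroup.induction with
  | mem i => exact exists_wordProd_eq_of_mem b (ofIdx_mem_closure_support b i)
  | one => exact ⟨[], by simp, rfl⟩
  | mul x y hx hy hx' hy' =>
    obtain ⟨l, hl, h⟩ := hx'
    obtain ⟨l', hl', h'⟩ := hy'
    refine ⟨l ++ l', fun i hi => ?_, ?_⟩
    · rcases List.mem_append.1 hi with hi | hi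
      exacts [hl i hi, hl' i hi]
    · rw [wordProd_append, h, h']
      rfl

omit [P.IsRootSystem] in
/-- The exchange condition. -/
theorem IsInvariant.exists_wordProd_mul (h : IsInvariant P) (l : List ι)
    (hl : ∀ i ∈ l, i ∈ b.support) {i : ι} (hi : i ∈ b.support)
    (hneg : ¬ b.IsPos (wordProd P l • i)) :
    ∃ l' : List ι, (∀ i ∈ l', i ∈ b.support) ∧ l'.length + 1 = l.length ∧
      wordProd P l' = wordProd P l * RootPairing.weylGroup.ofIdx P i := by
  induction l with
  | nil =>
    rw [wordProd_nil, one_smul] at hneg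
    exact absurd (RootPairing.Base.isPos_of_mem_support hi) hneg
  | cons j l ih =>
    have hl' : ∀ i ∈ l, i ∈ b.support := fun k hk => hl k (List.mem_cons_of_mem _ hk)
    have hj : j ∈ b.support := hl j List.mem_cons_self
    by_cases hp : b.IsPos (wordProd P l • i)
    -- A simple reflection `s_j` keeps every positive root other than `α_j` positive, so the root
    -- that changes sign here is `α_j` itself.
    · have hij : wordProd P l • i = j := by
        by_contra hne
        refine hneg ?_
        rw [wordProd_cons, mul_smul, ofIdx_smul_index]
        exact hp.reflectionPerm hj hne
      refine ⟨l, hl', rfl, ?_⟩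
      rw [wordProd_cons, mul_assoc, h.mul_ofIdx, hij, ← mul_assoc, ofIdx_mul_self, one_mul]
    · obtain ⟨l', h₁, h₂, h₃⟩ := ih hl' hp
      refine ⟨j :: l', ?_, by simpa using h₂, by rw [wordProd_cons, wordProd_cons, h₃, mul_assoc]⟩
      intro k hk
      rcases List.mem_cons.1 hk with rfl | hk
      exacts [hj, h₁ k hk]

omit [P.IsRootSystem] [Finite ι] [P.IsCrystallographic] [P.IsReduced] in
theorem isPos_reflectionPerm_self (i : ι) :
    b.IsPos (P.reflectionPerm i i) ↔ ¬ b.IsPos i := by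
  exact RootPairing.Base.IsPos.neg_iff_not b i

/-- Induction on word length, looking at the last letter `i`. If `w α_i` is positive, the word
without `i` makes `α_i` negative, and exchange gives a shorter word for `w`. If `w α_i` is negative,
then `(u, α_i) = (v, w α_i) ≤ 0`, so `s_i` fixes `u` and `w` can be replaced by the shorter `w s_i`.
-/
theorem IsInvariant.wordProd_smul_dominant (h : IsInvariant P) (l : List ι)
    (hl : ∀ i ∈ l, i ∈ b.support) {u v : E} (hu : IsDominant b u) (hv : IsDominant b v)
    (huv : wordProd P l • u = v) :
    u = v ∧ wordProd P l ∈
      parabolicSubgroup P {i | i ∈ b.support ∧ inner ℝ u (P.root i) = 0} := by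
  induction hn : l.length using Nat.strong_induction_on generalizing l with
  | _ n ih =>
    rcases List.eq_nil_or_concat l with rfl | ⟨l', i, rfl⟩
    · rw [wordProd_nil, one_smul] at huv
      exact ⟨huv, one_mem _⟩
    · rw [List.concat_eq_append] at *
      have hi : i ∈ b.support := hl i (by simp)
      have hl' : ∀ j ∈ l', j ∈ b.support := fun j hj => hl j (by simp [hj])
      have hlen : l'.length + 1 = n := by simpa using hn
      by_cases hp : b.IsPos (wordProd P (l' ++ [i]) • i)
      · have hneg : ¬ b.IsPos (wordProd P l' • i) := by
          rw [wordProd_append, wordProd_cons, wordProd_nil, mul_one, mul_smul,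
            ofIdx_smul_index] at hp
          have : wordProd P l' • P.reflectionPerm i i =
              P.reflectionPerm (wordProd P l' • i) (wordProd P l' • i) := by
            apply P.root.injective
            rw [root_smul, P.root_reflectionPerm, P.root_reflectionPerm, P.reflection_apply_self,
              P.reflection_apply_self, root_smul, smul_neg]
          rwa [this, isPos_reflectionPerm_self] at hp
        obtain ⟨l'', h₁, h₂, h₃⟩ := h.exists_wordProd_mul l' hl' hi hneg
        have heq : wordProd P (l' ++ [i]) = wordProd P l'' := by
          rw [h₃, wordProd_append, wordProd_cons, wordProd_nil, mul_one]
        rw [heq] at huv ⊢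
        exact ih l''.length (by omega) l'' h₁ huv rfl
      · obtain ⟨l'', h₁, h₂, h₃⟩ := h.exists_wordProd_mul _ hl hi hp
        have hzero : inner ℝ u (P.root i) = 0 := by
          refine le_antisymm ?_ (hu i hi)
          rw [← h.inner_smul_smul (wordProd P (l' ++ [i])), huv, ← root_smul]
          exact hv.inner_nonpos hp
        have heq : wordProd P (l' ++ [i]) = wordProd P l'' * RootPairing.weylGroup.ofIdx P i := by
          rw [h₃, mul_assoc, ofIdx_mul_self, mul_one]
        rw [heq, mul_smul, ofIdx_smul_vector, h.reflection_eq_self hzero] at huv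
        obtain ⟨h₄, h₅⟩ := ih l''.length (by omega) l'' h₁ huv rfl
        refine ⟨h₄, ?_⟩
        rw [heq]
        exact mul_mem h₅ (Subgroup.subset_closure ⟨i, ⟨hi, hzero⟩, rfl⟩)

/-- The dominant chamber is a fundamental domain, and stabilizers of dominant vectors are standard
parabolic subgroups. -/
theorem IsInvariant.smul_dominant (h : IsInvariant P) (w : P.weylGroup) {u v : E}
    (hu : IsDominant b u) (hv : IsDominant b v) (huv : w • u = v) :
    u = v ∧ w ∈ parabolicSubgroup P {i | i ∈ b.support ∧ inner ℝ u (P.root i) = 0} := by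
  obtain ⟨l, hl, rfl⟩ := exists_wordProd_eq b w
  exact h.wordProd_smul_dominant l hl hu hv huv

end WeylGroup

-- The highest root

section HighestRoot

variable {ι E N : Type*} [Finite ι] [NormedAddCommGroup E] [InnerProductSpace ℝ E]
  [AddCommGroup N] [Module ℝ N] {P : RootPairing ι ℝ E N} [P.IsRootSystem] [P.IsCrystallographic]
  [P.IsReduced] {b : P.Base} {θ : ι}

omit [Finite ι] [P.IsRootSystem] [P.IsReduced] in
theorem IsInvariant.pairingIn_pos_iff (h : IsInvariant P) (i j : ι) :
    0 < P.pairingIn ℤ i j ↔ 0 < inner ℝ (P.root i) (P.root j) := by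
  have h₁ := h.coroot'_mul j (P.root i)
  have h₂ := inner_root_self_pos (P := P) j
  rw [P.root_coroot'_eq_pairing, ← P.algebraMap_pairingIn ℤ] at h₁
  rw [← Int.cast_pos (R := ℝ)]
  change ((P.pairingIn ℤ i j : ℤ) : ℝ) * _ = _ at h₁
  constructor <;> intro h₃
  · have := mul_pos h₃ h₂
    linarith
  · exact pos_of_mul_pos_left (by linarith) h₂.le

omit [P.IsRootSystem] [P.IsReduced] in
theorem IsInvariant.inner_simple_nonpos (h : IsInvariant P) {i j : ι} (hi : i ∈ b.support)
    (hj : j ∈ b.support) (hij : i ≠ j) : inner ℝ (P.root i) (P.root j) ≤ 0 := by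
  have := b.pairingIn_le_zero_of_ne hij hi hj
  rw [← not_lt] at this ⊢
  rwa [← h.pairingIn_pos_iff]

omit [Finite ι] [P.IsCrystallographic] [P.IsReduced] in
theorem IsInvariant.height_lt_reflectionPerm (h : IsInvariant P) {i j : ι} (hi : i ∈ b.support)
    (hneg : inner ℝ (P.root j) (P.root i) < 0) :
    b.height j < b.height (P.reflectionPerm i j) := by
  lift i to b.support using hi
  rw [← Int.cast_lt (R := ℝ), ← sum_coord_root, ← sum_coord_root, P.root_reflectionPerm]
  simp only [h.coord_reflection, Finset.sum_sub_distrib, Finset.sum_ite_eq, Finset.mem_univ,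
    if_true]
  have : 2 * inner ℝ (P.root j) (P.root i) / inner ℝ (P.root i) (P.root i) < 0 :=
    div_neg_of_neg_of_pos (by linarith) (inner_root_self_pos _)
  linarith

omit [Finite ι] [P.IsCrystallographic] [P.IsReduced] in
theorem IsInvariant.coord_le_reflectionPerm (h : IsInvariant P) {i j : ι} (hi : i ∈ b.support)
    (hneg : inner ℝ (P.root j) (P.root i) < 0) (k : b.support) :
    b.toWeightBasis.repr (P.root j) k ≤ b.toWeightBasis.repr (P.root (P.reflectionPerm i j)) k := by
  lift i to b.support using hi
  rw [P.root_reflectionPerm, h.coord_reflection]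
  have : 2 * inner ℝ (P.root j) (P.root i) / inner ℝ (P.root i) (P.root i) < 0 :=
    div_neg_of_neg_of_pos (by linarith) (inner_root_self_pos _)
  split_ifs <;> linarith

omit [Finite ι] [P.IsCrystallographic] [P.IsReduced] in
theorem IsHighestRoot.isDominant (hθ : IsHighestRoot b θ) (h : IsInvariant P) :
    IsDominant b (P.root θ) := by
  intro i hi
  by_contra! hneg
  exact absurd (hθ _) (not_le.2 (h.height_lt_reflectionPerm hi hneg))

omit [Finite ι] [P.IsRootSystem] [P.IsCrystallographic] [P.IsReduced] in
theorem IsHighestRoot.isPos (hθ : IsHighestRoot b θ) : b.IsPos θ := by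
  have : Nonempty ι := ⟨θ⟩
  obtain ⟨i, hi⟩ := b.support_nonempty
  exact (RootPairing.Base.isPos_of_mem_support hi : 0 < b.height i).trans_le (hθ i)

omit [P.IsRootSystem] in
/-- The Dynkin diagram of an irreducible root system is connected. -/
theorem IsInvariant.eq_support_of_orthogonal [P.IsIrreducible] (h : IsInvariant P) {S : Set ι}
    (hS : S ⊆ b.support) (hne : S.Nonempty)
    (horth : ∀ i ∈ S, ∀ j ∈ b.support, j ∉ S → inner ℝ (P.root i) (P.root j) = 0) :
    S = b.support := by
  have hq := RootPairing.IsIrreducible.eq_top_of_invtSubmodule_reflection (P := P)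
    -- This span is nonzero and stable under simple reflections, hence under all reflections, so it
    -- is everything; a simple root outside `S` would then be orthogonal to itself.
    (Submodule.span ℝ (P.root '' S)) ?_ ?_
  · refine hS.antisymm fun j hj => ?_
    by_contra hjS
    have h₁ : P.root j ∈ Submodule.span ℝ (P.root '' S) := hq ▸ Submodule.mem_top
    have h₂ : Submodule.span ℝ (P.root '' S) ≤ LinearMap.ker (innerₛₗ ℝ (P.root j)) := by
      rw [Submodule.span_le]
      rintro _ ⟨i, hi, rfl⟩
      change inner ℝ (P.root j) (P.root i) = 0
      rw [real_inner_comm]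
      exact horth i hi j hj hjS
    exact (inner_root_self_pos (P := P) j).ne' (h₂ h₁)
  · refine (b.forall_mem_support_invtSubmodule_iff _).1 fun j hj => ?_
    rw [Module.End.mem_invtSubmodule, Submodule.span_le]
    rintro _ ⟨i, hi, rfl⟩
    change P.reflection j (P.root i) ∈ Submodule.span ℝ (P.root '' S)
    have hi' : P.root i ∈ Submodule.span ℝ (P.root '' S) :=
      Submodule.subset_span (Set.mem_image_of_mem _ hi)
    by_cases hjS : j ∈ S
    · rw [h.reflection_eq]
      exact Submodule.sub_mem _ hi'
        (Submodule.smul_mem _ _ (Submodule.subset_span (Set.mem_image_of_mem _ hjS)))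
    · rwa [h.reflection_eq_self (horth i hi j hj hjS)]
  · obtain ⟨i, hi⟩ := hne
    intro hbot
    have : P.root i ∈ Submodule.span ℝ (P.root '' S) :=
      Submodule.subset_span (Set.mem_image_of_mem _ hi)
    rw [hbot, Submodule.mem_bot] at this
    exact P.ne_zero i this

/-- If `θ` has zero coordinate at `j`, then `(θ, α_j)` is a sum of nonpositive terms, yet
nonnegative by dominance. All terms vanish, so the support of `θ` is orthogonal to its complement,
and connectedness applies. -/
theorem IsHighestRoot.coord_pos [P.IsIrreducible] (hθ : IsHighestRoot b θ) (h : IsInvariant P)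
    (k : b.support) : 0 < b.toWeightBasis.repr (P.root θ) k := by
  have hnn := coord_nonneg_of_isPos b hθ.isPos
  have hS : {i : ι | ∃ hi : i ∈ b.support, 0 < b.toWeightBasis.repr (P.root θ) ⟨i, hi⟩} =
      b.support := by
    refine h.eq_support_of_orthogonal (fun i hi => hi.1) ?_ ?_
    · by_contra hemp
      have hzero : ∀ j, b.toWeightBasis.repr (P.root θ) j = 0 := fun j =>
        le_antisymm (not_lt.1 fun hj => hemp ⟨j, j.2, hj⟩) (hnn j)
      refine P.ne_zero θ (b.toWeightBasis.repr.injective ?_)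
      rw [map_zero]
      exact Finsupp.ext hzero
    · rintro i ⟨hi, hi'⟩ j hj hjS
      have h₁ := hθ.isDominant h j hj
      rw [real_inner_comm, inner_eq_sum_coord b] at h₁
      have h₂ : ∀ m : b.support, b.toWeightBasis.repr (P.root θ) m *
          inner ℝ (P.root j) (P.root m) ≤ 0 := by
        intro m
        by_cases hm : j = m
        · have : b.toWeightBasis.repr (P.root θ) m = 0 := by
            refine le_antisymm (not_lt.1 fun hlt => hjS ⟨hj, ?_⟩) (hnn m)
            subst hm
            exact hlt
          simp [this]
        · exact mul_nonpos_of_nonneg_of_nonpos (hnn m) (h.inner_simple_nonpos hj m.2 hm)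
      have h₃ := (Finset.sum_eq_zero_iff_of_nonpos fun m _ => h₂ m).1
        (le_antisymm (Finset.sum_nonpos fun m _ => h₂ m) h₁) ⟨i, hi⟩ (Finset.mem_univ _)
      rw [real_inner_comm]
      exact (mul_eq_zero.1 h₃).resolve_left hi'.ne'
  obtain ⟨_, hk⟩ := hS.ge k.2
  exact hk

/-- Every root is coordinatewise bounded by the highest root. -/
theorem IsHighestRoot.coord_le [P.IsIrreducible] (hθ : IsHighestRoot b θ) (h : IsInvariant P)
    (i : ι) (k : b.support) :
    b.toWeightBasis.repr (P.root i) k ≤ b.toWeightBasis.repr (P.root θ) k := by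
  have : Nonempty {m : ι // ∀ k, b.toWeightBasis.repr (P.root i) k ≤
      b.toWeightBasis.repr (P.root m) k} := ⟨⟨i, fun _ => le_rfl⟩⟩
  -- A root of greatest height among those lying above root `i`; reflecting it upward would stay in
  -- this set, so it is dominant.
  obtain ⟨⟨m, hm⟩, hmax⟩ := Finite.exists_max
    fun m : {m : ι // ∀ k, b.toWeightBasis.repr (P.root i) k ≤
      b.toWeightBasis.repr (P.root m) k} => b.height m
  by_cases hmθ : m = θ
  · exact hmθ ▸ hm k
  have hdom : IsDominant b (P.root m) := by
    intro j hj
    by_contra! hneg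
    exact absurd (hmax ⟨P.reflectionPerm j m, fun k =>
      (hm k).trans (h.coord_le_reflectionPerm hj hneg k)⟩)
      (not_le.2 (h.height_lt_reflectionPerm hj hneg))
  have hpos : 0 < inner ℝ (P.root m) (P.root θ) := by
    refine (hdom.inner_nonneg hθ.isPos).lt_of_ne fun hzero => ?_
    rw [inner_eq_sum_coord b, eq_comm, Finset.sum_eq_zero_iff_of_nonneg fun j _ =>
      mul_nonneg (hθ.coord_pos h j).le (hdom j j.2)] at hzero
    have : inner ℝ (P.root m) (P.root m) = 0 := by
      rw [inner_eq_sum_coord b]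
      refine Finset.sum_eq_zero fun j hj => ?_
      rw [(mul_eq_zero.1 (hzero j hj)).resolve_left (hθ.coord_pos h j).ne', mul_zero]
    exact (inner_root_self_pos m).ne' this
  -- The difference `m - θ` is a root of nonpositive height, so all its coordinates are nonpositive.
  obtain ⟨j, hj⟩ := P.root_sub_root_mem_of_pairingIn_pos ((h.pairingIn_pos_iff m θ).2 hpos) hmθ
  have hneg : ¬ b.IsPos j := by
    rw [RootPairing.Base.isPos_iff, b.height_sub hj]
    have := hθ m
    omega
  have := coord_nonpos_of_not_isPos b hneg k
  rw [hj, map_sub, Finsupp.sub_apply] at this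
  linarith [hm k]

end HighestRoot

-- Irreducibility of the affine subsystem as a condition on `Γ` and `θ`

section AffineSubsystem

variable {ι E N : Type*} [NormedAddCommGroup E] [InnerProductSpace ℝ E]
  [AddCommGroup N] [Module ℝ N] {P : RootPairing ι ℝ E N} {b : P.Base} {θ : ι}

/-- Every connected component of `Γ` has a root that is not orthogonal to `θ`. -/
def IsLinked (P : RootPairing ι ℝ E N) (θ : ι) (Γ : Finset ι) : Prop :=
  ∀ A : Set ι, A ⊆ Γ → (∀ i ∈ A, inner ℝ (P.root i) (P.root θ) = 0) →
    (∀ i ∈ A, ∀ j ∈ Γ, j ∉ A → inner ℝ (P.root i) (P.root j) = 0) → A = ∅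

theorem IsInvariant.affineReflection_mem [P.IsCrystallographic] (h : IsInvariant P) {a x : E × ℝ}
    (ha : a ∈ affineRoots P) (hx : x ∈ affineRoots P) : affineReflection a x ∈ affineRoots P := by
  obtain ⟨i, k, rfl⟩ := ha
  obtain ⟨j, m, rfl⟩ := hx
  refine ⟨P.reflectionPerm i j, m - P.pairingIn ℤ j i * k, ?_⟩
  have hp : (P.pairingIn ℤ j i : ℝ) =
      2 * inner ℝ (P.root j) (P.root i) / inner ℝ (P.root i) (P.root i) := by
    rw [← h.coroot'_eq, P.root_coroot'_eq_pairing]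
    exact P.algebraMap_pairingIn ℤ j i
  rw [P.root_reflectionPerm, h.reflection_eq]
  push_cast
  rw [hp]
  rfl

theorem extended_subset_affineRoots (Γ : Finset ι) : extended P θ Γ ⊆ affineRoots P := by
  rintro x (rfl | ⟨i, -, rfl⟩)
  · exact ⟨P.reflectionPerm θ θ, 1, by
      rw [P.root_reflectionPerm, P.reflection_apply_self, Int.cast_one]⟩
  · exact ⟨i, 0, by simp⟩

theorem subset_generatedSubsystem (S : Set (E × ℝ)) : S ⊆ generatedSubsystem P S :=
  Set.subset_sInter fun _ hT => hT.1

theorem generatedSubsystem_subset {S T : Set (E × ℝ)} (h₁ : S ⊆ T) (h₂ : T ⊆ affineRoots P)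
    (h₃ : ∀ a ∈ T, ∀ x ∈ T, affineReflection a x ∈ T) : generatedSubsystem P S ⊆ T :=
  Set.sInter_subset_of_mem ⟨h₁, h₂, h₃⟩

theorem affineReflection_eq_self {a x : E × ℝ} (h : affineForm x a = 0) :
    affineReflection a x = x := by
  simp [affineReflection, h]

/-- Affine roots with finite part in `U` or `V` are stable under their own reflections: within one
subspace by linearity, across the two because the reflection acts trivially. -/
theorem IsInvariant.generatedSubsystem_subset_of_orthogonal [P.IsCrystallographic]
    (h : IsInvariant P) {S : Set (E × ℝ)} (hS : S ⊆ affineRoots P) {U V : Submodule ℝ E}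
    (hUV : ∀ u ∈ U, ∀ v ∈ V, inner ℝ u v = 0) (hSUV : ∀ x ∈ S, x.1 ∈ U ∨ x.1 ∈ V) {x : E × ℝ}
    (hx : x ∈ generatedSubsystem P S) : x ∈ affineRoots P ∧ (x.1 ∈ U ∨ x.1 ∈ V) := by
  refine generatedSubsystem_subset (T := {x | x ∈ affineRoots P ∧ (x.1 ∈ U ∨ x.1 ∈ V)})
    (fun x hx => ⟨hS hx, hSUV x hx⟩) (fun x hx => hx.1) ?_ hx
  rintro a ⟨ha, ha'⟩ x ⟨hx, hx'⟩
  refine ⟨h.affineReflection_mem ha hx, ?_⟩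
  rcases ha' with ha' | ha' <;> rcases hx' with hx' | hx'
  · exact Or.inl (U.sub_mem hx' (U.smul_mem _ ha'))
  · rw [affineReflection_eq_self]
    · exact Or.inr hx'
    · rw [affineForm, real_inner_comm]
      exact hUV _ ha' _ hx'
  · rw [affineReflection_eq_self (hUV _ hx' _ ha')]
    exact Or.inl hx'
  · exact Or.inr (V.sub_mem hx' (V.smul_mem _ ha'))

theorem fst_ne_zero_of_mem_affineRoots {x : E × ℝ} (hx : x ∈ affineRoots P) : x.1 ≠ 0 := by
  obtain ⟨i, k, rfl⟩ := hx
  exact P.ne_zero i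

/-- A nonempty `A` violating linkedness splits the subsystem into roots with finite part in `span
A`, and those, including `α₀`, with finite part in its orthogonal complement. -/
theorem IsInvariant.isLinked_of_isIrreducibleSubsystem [P.IsCrystallographic] (h : IsInvariant P)
    {Γ : Finset ι} (hΓ : IsIrreducibleSubsystem (generatedSubsystem P (extended P θ Γ))) :
    IsLinked P θ Γ := by
  intro A hA hAθ hAΓ
  by_contra hne
  obtain ⟨i, hi⟩ := Set.nonempty_iff_ne_empty.2 hne
  set U := Submodule.span ℝ (P.root '' A) with hU
  have hroot : ∀ j ∈ A, P.root j ∈ U := fun j hj => Submodule.subset_span ⟨j, hj, rfl⟩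
  have hperp : ∀ x : E, (∀ j ∈ A, inner ℝ (P.root j) x = 0) → x ∈ Uᗮ := by
    intro x hx
    rw [hU, Submodule.mem_orthogonal]
    intro u hu
    induction hu using Submodule.span_induction with
    | mem y hy =>
      obtain ⟨j, hj, rfl⟩ := hy
      exact hx j hj
    | zero => exact inner_zero_left _
    | add y z _ _ hy hz => rw [inner_add_left, hy, hz, add_zero]
    | smul c y _ hy => rw [real_inner_smul_left, hy, mul_zero]
  have hθU : -P.root θ ∈ Uᗮ := Submodule.neg_mem _ (hperp _ hAθ)
  have hgen : ∀ x ∈ generatedSubsystem P (extended P θ Γ),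
      x ∈ affineRoots P ∧ (x.1 ∈ U ∨ x.1 ∈ Uᗮ) := fun x hx =>
    h.generatedSubsystem_subset_of_orthogonal (extended_subset_affineRoots Γ)
      (fun u hu v hv => (Submodule.mem_orthogonal _ _).1 hv u hu) (by
        rintro x (rfl | ⟨j, hj, rfl⟩)
        · exact Or.inr hθU
        · by_cases hjA : j ∈ A
          · exact Or.inl (hroot j hjA)
          · exact Or.inr (hperp _ fun k hk => hAΓ k hk j hj hjA)) hx
  set G := generatedSubsystem P (extended P θ Γ)
  have hirr := hΓ.2 (G ∩ {x | x.1 ∈ U}) (G ∩ {x | x.1 ∈ Uᗮ}) ?_ ?_ ?_ ?_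
  · obtain ⟨a, ha, c, hc, hac⟩ := hirr
    exact hac ((Submodule.mem_orthogonal _ _).1 hc.2 _ ha.2)
  · rw [← Set.inter_union_distrib_left]
    refine Set.inter_eq_left.2 ?_
    exact fun x hx => (hgen x hx).2
  · rw [Set.disjoint_left]
    rintro x ⟨hx, hx₁⟩ ⟨-, hx₂⟩
    exact fst_ne_zero_of_mem_affineRoots (hgen x hx).1
      (inner_self_eq_zero.1 ((Submodule.mem_orthogonal _ _).1 hx₂ _ hx₁))
  · exact ⟨(P.root i, 0), subset_generatedSubsystem _ (Or.inr ⟨i, hA hi, rfl⟩), hroot i hi⟩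
  · exact ⟨(-P.root θ, 1), subset_generatedSubsystem _ (Or.inl rfl), hθU⟩

/-- In an orthogonal splitting, the elements of `Γ` on the side away from `α₀` would violate
linkedness, so all generators lie on the side of `α₀`. A root on the other side has finite part in
the span of the generators and orthogonal to it, which is impossible. -/
theorem IsInvariant.isIrreducibleSubsystem_of_isLinked [P.IsCrystallographic] (h : IsInvariant P)
    {Γ : Finset ι} (hΓ : IsLinked P θ Γ) :
    IsIrreducibleSubsystem (generatedSubsystem P (extended P θ Γ)) := by
  have hα₀ : ((-P.root θ, 1) : E × ℝ) ∈ generatedSubsystem P (extended P θ Γ) :=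
    subset_generatedSubsystem _ (Or.inl rfl)
  refine ⟨⟨_, hα₀⟩, ?_⟩
  suffices key : ∀ A B : Set (E × ℝ), A ∪ B = generatedSubsystem P (extended P θ Γ) →
      (-P.root θ, 1) ∈ A → Disjoint A B → B.Nonempty → ∃ a ∈ A, ∃ c ∈ B, affineForm a c ≠ 0 by
    intro A B hAB hdisj hA hB
    rcases hAB.ge hα₀ with hmem | hmem
    · exact key A B hAB hmem hdisj hB
    · obtain ⟨a, ha, c, hc, hac⟩ := key B A (by rwa [Set.union_comm]) hmem hdisj.symm hA
      exact ⟨c, hc, a, ha, by rwa [affineForm, real_inner_comm]⟩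
  intro A B hAB hmem hdisj ⟨d, hd⟩
  by_contra! horth
  have hΓG : ∀ j ∈ Γ, ((P.root j, 0) : E × ℝ) ∈ A ∪ B := fun j hj =>
    hAB ▸ subset_generatedSubsystem _ (Or.inr ⟨j, hj, rfl⟩)
  have hempty : {j | j ∈ Γ ∧ ((P.root j, 0) : E × ℝ) ∈ B} = ∅ := by
    refine hΓ _ (fun j hj => hj.1) ?_ ?_
    · rintro j ⟨-, hj⟩
      have := horth _ hmem _ hj
      rw [affineForm, inner_neg_left, neg_eq_zero] at this
      rwa [real_inner_comm]
    · rintro i ⟨hi, hi'⟩ j hj hj'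
      have hjA : ((P.root j, 0) : E × ℝ) ∈ A :=
        (hΓG j hj).resolve_right fun hjB => hj' ⟨hj, hjB⟩
      have := horth _ hjA _ hi'
      rwa [affineForm, real_inner_comm] at this
  have hΓA : ∀ x ∈ extended P θ Γ, x ∈ A := by
    rintro x (rfl | ⟨j, hj, rfl⟩)
    · exact hmem
    · exact (hΓG j hj).resolve_right fun hjB => Set.eq_empty_iff_forall_notMem.1 hempty j ⟨hj, hjB⟩
  obtain ⟨hd₁, hd₂⟩ := h.generatedSubsystem_subset_of_orthogonal (extended_subset_affineRoots Γ)
    -- With `V = ⊥` the dichotomy just says that finite parts stay in the span of the generators.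
    (U := Submodule.span ℝ (Prod.fst '' extended P θ Γ)) (V := ⊥)
    (fun u _ v hv => by rw [(Submodule.mem_bot ℝ).1 hv, inner_zero_right])
    (fun x hx => Or.inl (Submodule.subset_span ⟨x, hx, rfl⟩)) (hAB.le (Or.inr hd))
  refine fst_ne_zero_of_mem_affineRoots hd₁ ?_
  rcases hd₂ with hd₂ | hd₂
  · have hker : Submodule.span ℝ (Prod.fst '' extended P θ Γ) ≤
        LinearMap.ker (innerₛₗ ℝ d.1) := by
      rw [Submodule.span_le]
      rintro _ ⟨x, hx, rfl⟩
      change inner ℝ d.1 x.1 = 0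
      rw [real_inner_comm]
      exact horth x (hΓA x hx) d hd
    exact inner_self_eq_zero.1 (hker hd₂)
  · exact hd₂

theorem IsInvariant.mem_irreducibleFamily [P.IsCrystallographic] (h : IsInvariant P)
    {Γ : Finset ι} : Γ ∈ irreducibleFamily b θ ↔ Γ ⊆ b.support ∧ IsLinked P θ Γ := by
  simp only [irreducibleFamily, Finset.mem_filter, Finset.mem_powerset]
  exact and_congr_right fun _ =>
    ⟨h.isLinked_of_isIrreducibleSubsystem, h.isIrreducibleSubsystem_of_isLinked⟩

end AffineSubsystem

-- Convex hulls and supporting functionals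

open Pointwise

/-- If a linear functional is bounded by `m` on `s`, the points of the convex hull of `s` where the
bound is attained are convex combinations of points of `s` where it is attained. -/
theorem mem_convexHull_inter_of_eq {V : Type*} [AddCommGroup V] [Module ℝ V] {s : Set V}
    (f : V →ₗ[ℝ] ℝ) {m : ℝ} (hs : ∀ x ∈ s, f x ≤ m) {x : V} (hx : x ∈ convexHull ℝ s)
    (hfx : f x = m) : x ∈ convexHull ℝ (s ∩ {y | f y = m}) := by
  suffices h : convexHull ℝ s ⊆ {x | f x ≤ m ∧ (f x = m → x ∈ convexHull ℝ (s ∩ {y | f y = m}))}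
    from (h hx).2 hfx
  refine convexHull_min (fun y hy => ⟨hs y hy, fun h => subset_convexHull ℝ _ ⟨hy, h⟩⟩) ?_
  rintro y ⟨hy₁, hy₂⟩ z ⟨hz₁, hz₂⟩ c d hc hd hcd
  have hcd' : c * m + d * m = m := by rw [← add_mul, hcd, one_mul]
  have h₁ := mul_le_mul_of_nonneg_left hy₁ hc
  have h₂ := mul_le_mul_of_nonneg_left hz₁ hd
  simp only [Set.mem_ofPred_eq, map_add, map_smul, smul_eq_mul]
  refine ⟨by linarith, fun heq => ?_⟩
  rcases hc.eq_or_lt with rfl | hc'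
  · rw [zero_add] at hcd
    subst hcd
    simpa using hz₂ (by linarith)
  rcases hd.eq_or_lt with rfl | hd'
  · rw [add_zero] at hcd
    subst hcd
    simpa using hy₂ (by linarith)
  exact convex_convexHull ℝ _ (hy₂ (mul_left_cancel₀ hc'.ne' (by linarith)))
    (hz₂ (mul_left_cancel₀ hd'.ne' (by linarith))) hc hd hcd

-- Standard faces and redundant components of `Γ`

section Faces

variable {ι E N : Type*} [NormedAddCommGroup E] [InnerProductSpace ℝ E]
  [AddCommGroup N] [Module ℝ N] {P : RootPairing ι ℝ E N}

theorem root_mem_rootPolytope (i : ι) : P.root i ∈ rootPolytope P :=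
  subset_convexHull ℝ _ (Set.mem_range_self i)

theorem smul_mem_rootPolytope (w : P.weylGroup) {x : E} (hx : x ∈ rootPolytope P) :
    w • x ∈ rootPolytope P := by
  have : (RootPairing.Equiv.weightHom P w : E →ₗ[ℝ] E) '' rootPolytope P ⊆ rootPolytope P := by
    rw [rootPolytope, LinearMap.image_convexHull]
    refine convexHull_mono ?_
    rintro _ ⟨_, ⟨i, rfl⟩, rfl⟩
    exact ⟨w • i, root_smul w i⟩
  exact this ⟨x, hx, rfl⟩

section

variable [Finite ι]

/-- The sum of the roots that lie in a set. -/
noncomputable def rootSum (P : RootPairing ι ℝ E N) (F : Set E) : E :=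
  ∑ j ∈ (Set.toFinite {j | P.root j ∈ F}).toFinset, P.root j

theorem mem_of_mem_toFinset {F : Set E} {j : ι}
    (hj : j ∈ (Set.toFinite {j | P.root j ∈ F}).toFinset) : P.root j ∈ F :=
  (Set.Finite.mem_toFinset (Set.toFinite {j | P.root j ∈ F})).1 hj

theorem smul_rootSum (w : P.weylGroup) (F : Set E) : w • rootSum P F = rootSum P (w • F) := by
  rw [rootSum, rootSum, Finset.smul_sum]
  refine Finset.sum_equiv (MulAction.toPerm w) (fun j => ?_) fun j _ => (root_smul w j).symm
  simp only [Set.Finite.mem_toFinset, Set.mem_ofPred_eq, MulAction.toPerm_apply, root_smul,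
    Set.smul_mem_smul_set_iff]

end

variable [P.IsRootSystem] {b : P.Base} {θ : ι}

theorem mem_span_of_coord_eq_zero {Γ : Finset ι} {x : E}
    (hx : ∀ k : b.support, (k : ι) ∉ Γ → b.toWeightBasis.repr x k = 0) :
    x ∈ Submodule.span ℝ (P.root '' Γ) := by
  rw [← b.toWeightBasis.sum_repr x]
  refine Submodule.sum_mem _ fun k _ => ?_
  by_cases hk : (k : ι) ∈ Γ
  · exact Submodule.smul_mem _ _ (Submodule.subset_span ⟨k, hk, by simp⟩)
  · rw [hx k hk, zero_smul]
    exact Submodule.zero_mem _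

theorem root_highest_mem_standardFace (Γ : Finset ι) : P.root θ ∈ standardFace b θ Γ :=
  ⟨root_mem_rootPolytope θ, fun _ _ => rfl⟩

theorem IsInvariant.reflection_mem_standardFace (h : IsInvariant P) {Γ : Finset ι}
    (hΓ : Γ ⊆ b.support) {i : ι} (hi : i ∈ Γ) {x : E} (hx : x ∈ standardFace b θ Γ) :
    P.reflection i x ∈ standardFace b θ Γ := by
  refine ⟨smul_mem_rootPolytope (RootPairing.weylGroup.ofIdx P i) hx.1, fun k hk => ?_⟩
  have := h.coord_reflection b ⟨i, hΓ hi⟩ k x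
  rw [this, if_neg, sub_zero, hx.2 k hk]
  rintro rfl
  exact hk hi

variable [Finite ι] [P.IsCrystallographic] [P.IsReduced] [P.IsIrreducible]

theorem IsHighestRoot.coord_le_of_mem (hθ : IsHighestRoot b θ) (h : IsInvariant P) {x : E}
    (hx : x ∈ rootPolytope P) (k : b.support) :
    b.toWeightBasis.repr x k ≤ b.toWeightBasis.repr (P.root θ) k := by
  have : rootPolytope P ⊆ {x | b.toWeightBasis.coord k x ≤ b.toWeightBasis.repr (P.root θ) k} := by
    refine convexHull_min ?_ (convex_halfSpace_le (b.toWeightBasis.coord k).isLinear _)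
    rintro _ ⟨i, rfl⟩
    exact hθ.coord_le h i k
  exact this hx

omit [Finite ι] [P.IsCrystallographic] [P.IsReduced] [P.IsIrreducible] in
theorem inner_eq_sub_sum (θ : ι) (v x : E) :
    inner ℝ x v = inner ℝ (P.root θ) v - ∑ k : b.support,
      (b.toWeightBasis.repr (P.root θ) k - b.toWeightBasis.repr x k) * inner ℝ (P.root k) v := by
  have h₁ := inner_eq_sum_coord b v x
  have h₂ := inner_eq_sum_coord b v (P.root θ)
  simp only [sub_mul, Finset.sum_sub_distrib]
  rw [real_inner_comm, h₁, real_inner_comm, h₂]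
  simp only [real_inner_comm v]
  ring

omit [P.IsRootSystem] [Finite ι] [P.IsCrystallographic] [P.IsReduced] [P.IsIrreducible] in
theorem IsInvariant.inner_reflection_self (h : IsInvariant P) (i : ι) (x : E) :
    inner ℝ (P.reflection i x) (P.root i) = - inner ℝ x (P.root i) := by
  have := h i x (P.root i)
  rw [P.reflection_apply_self, inner_neg_right] at this
  linarith

/-- A root in a standard face agrees with the highest root on the components of `Γ` orthogonal to
the highest root. -/
theorem IsHighestRoot.coord_eq_of_orthogonal (hθ : IsHighestRoot b θ) (h : IsInvariant P)
    {Γ A : Finset ι} (hΓ : Γ ⊆ b.support) (hA : A ⊆ Γ)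
    (hAθ : ∀ i ∈ A, inner ℝ (P.root i) (P.root θ) = 0)
    (hAΓ : ∀ i ∈ A, ∀ j ∈ Γ, j ∉ A → inner ℝ (P.root i) (P.root j) = 0)
    {j : ι} (hj : P.root j ∈ standardFace b θ Γ) {k : b.support} (hk : (k : ι) ∈ A) :
    b.toWeightBasis.repr (P.root j) k = b.toWeightBasis.repr (P.root θ) k := by
  classical
  by_contra hne
  have : Nonempty {j : ι // P.root j ∈ standardFace b θ Γ ∧ ∃ k : b.support, (k : ι) ∈ A ∧
      b.toWeightBasis.repr (P.root j) k ≠ b.toWeightBasis.repr (P.root θ) k} :=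
    ⟨⟨j, hj, k, hk, hne⟩⟩
  obtain ⟨⟨m, hm, k', hk', hne'⟩, hmax⟩ := Finite.exists_max
    fun m : {j : ι // P.root j ∈ standardFace b θ Γ ∧ ∃ k : b.support, (k : ι) ∈ A ∧
      b.toWeightBasis.repr (P.root j) k ≠ b.toWeightBasis.repr (P.root θ) k} => b.height m
  -- The defect of `x` against `θ` on `A`. For `x` in the face, only this part of `θ - x` pairs
  -- nontrivially with the roots of `A`.
  let u : E → b.support → ℝ := fun x k =>
    if (k : ι) ∈ A then b.toWeightBasis.repr (P.root θ) k - b.toWeightBasis.repr x k else 0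
  have hinner : ∀ x ∈ standardFace b θ Γ, ∀ i ∈ A,
      inner ℝ x (P.root i) = - ∑ k, u x k * inner ℝ (P.root k) (P.root i) := by
    intro x hx i hi
    rw [inner_eq_sub_sum (b := b) θ, real_inner_comm, hAθ i hi, zero_sub]
    congr 1
    refine Finset.sum_congr rfl fun k _ => ?_
    simp only [u]
    split_ifs with hkA
    · rfl
    · by_cases hkΓ : (k : ι) ∈ Γ
      · rw [real_inner_comm, hAΓ i hi k hkΓ hkA, mul_zero, mul_zero]
      · rw [hx.2 k hkΓ, sub_self]
  set a : E := ∑ k, u (P.root m) k • b.toWeightBasis k with ha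
  have ha0 : a ≠ 0 := by
    intro h0
    have := b.toWeightBasis.repr_sum_self (u (P.root m))
    rw [← ha, h0, map_zero] at this
    have := congrFun this k'
    simp only [u, if_pos hk', Finsupp.coe_zero, Pi.zero_apply] at this
    exact hne' (by linarith)
  -- So `(m, a) < 0`, and since the defects are nonnegative some `i ∈ A` has `(m, α_i) < 0`. The
  -- reflected root is higher, hence has no defect by maximality of `m` and is orthogonal to `α_i`;
  -- but its inner product with `α_i` is `-(m, α_i) > 0`.
  have haa : inner ℝ (P.root m) a = - inner ℝ a a := by
    conv_lhs => rw [ha]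
    conv_rhs => rw [ha]; arg 1; arg 2; rw [← ha]
    rw [inner_sum, inner_sum, ← Finset.sum_neg_distrib]
    refine Finset.sum_congr rfl fun i _ => ?_
    rw [real_inner_smul_right, real_inner_smul_right, b.toWeightBasis_apply]
    by_cases hi : (i : ι) ∈ A
    · rw [hinner _ hm i hi, ha, sum_inner]
      simp [real_inner_smul_left]
    · simp [u, hi]
  have hapos : 0 < inner ℝ a a := real_inner_self_pos.2 ha0
  obtain ⟨i, hi⟩ : ∃ i : b.support, u (P.root m) i * inner ℝ (P.root m) (P.root i) < 0 := by
    by_contra! hnn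
    have : 0 ≤ inner ℝ (P.root m) a := by
      rw [ha, inner_sum]
      refine Finset.sum_nonneg fun i _ => ?_
      rw [real_inner_smul_right, b.toWeightBasis_apply]
      exact hnn i
    linarith
  have hiA : (i : ι) ∈ A := by
    by_contra hiA
    simp [u, hiA] at hi
  have hneg : inner ℝ (P.root m) (P.root i) < 0 := by
    refine neg_of_mul_neg_right hi ?_
    simp only [u, if_pos hiA, sub_nonneg]
    exact hθ.coord_le h m i
  have hmem := h.reflection_mem_standardFace hΓ (hA hiA) hm
  have hzero : ∀ k : b.support, u (P.reflection i (P.root m)) k = 0 := by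
    intro k
    simp only [u]
    split_ifs with hkA
    · by_contra hk
      rw [← P.root_reflectionPerm] at hmem hk
      have := hmax ⟨P.reflectionPerm i m, hmem, k, hkA, fun heq => hk (by rw [heq, sub_self])⟩
      exact absurd this (not_le.2 (h.height_lt_reflectionPerm i.2 hneg))
    · rfl
  have := hinner _ hmem i hiA
  rw [h.inner_reflection_self] at this
  simp only [hzero, zero_mul, Finset.sum_const_zero, neg_zero] at this
  linarith

open Classical in
theorem IsHighestRoot.standardFace_sdiff (hθ : IsHighestRoot b θ) (h : IsInvariant P)
    {Γ A : Finset ι} (hΓ : Γ ⊆ b.support) (hA : A ⊆ Γ)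
    (hAθ : ∀ i ∈ A, inner ℝ (P.root i) (P.root θ) = 0)
    (hAΓ : ∀ i ∈ A, ∀ j ∈ Γ, j ∉ A → inner ℝ (P.root i) (P.root j) = 0) :
    standardFace b θ (Γ \ A) = standardFace b θ Γ := by
  refine Set.Subset.antisymm (fun x hx => ⟨hx.1, fun k hk => hx.2 k fun hk' =>
    hk (Finset.mem_sdiff.1 hk').1⟩) fun x hx => ⟨hx.1, fun k hk => ?_⟩
  by_cases hkΓ : (k : ι) ∉ Γ
  · exact hx.2 k hkΓ
  have hkA : (k : ι) ∈ A := by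
    by_contra hkA
    exact hk (Finset.mem_sdiff.2 ⟨not_not.1 hkΓ, hkA⟩)
  -- Over the polytope this functional is largest exactly on the face, which reduces the claim from
  -- points of the face to roots in it.
  let f : E →ₗ[ℝ] ℝ := ∑ m : b.support, if (m : ι) ∈ Γ then 0 else b.toWeightBasis.coord m
  have hf : ∀ y, f y = ∑ m : b.support, if (m : ι) ∈ Γ then 0 else b.toWeightBasis.repr y m := by
    intro y
    simp only [f, LinearMap.sum_apply]
    refine Finset.sum_congr rfl fun m _ => ?_
    split_ifs <;> simp
  have hle : ∀ i, ∀ m ∈ (Finset.univ : Finset b.support), (if (m : ι) ∈ Γ then 0 else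
      b.toWeightBasis.repr (P.root i) m) ≤
      if (m : ι) ∈ Γ then 0 else b.toWeightBasis.repr (P.root θ) m := by
    intro i m _
    split_ifs
    · rfl
    · exact hθ.coord_le h i m
  have hmem := mem_convexHull_inter_of_eq f (m := f (P.root θ)) (s := Set.range P.root) (by
      rintro _ ⟨i, rfl⟩
      rw [hf, hf]
      exact Finset.sum_le_sum (hle i)) hx.1 (by
      rw [hf, hf]
      refine Finset.sum_congr rfl fun m _ => ?_
      split_ifs with hm
      · rfl
      · exact hx.2 m hm)
  have : convexHull ℝ (Set.range P.root ∩ {y | f y = f (P.root θ)}) ⊆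
      {y | b.toWeightBasis.coord k y = b.toWeightBasis.repr (P.root θ) k} := by
    refine convexHull_min ?_ (convex_hyperplane (b.toWeightBasis.coord k).isLinear _)
    rintro _ ⟨⟨i, rfl⟩, hi⟩
    change b.toWeightBasis.repr (P.root i) k = _
    refine hθ.coord_eq_of_orthogonal h hΓ hA hAθ hAΓ ⟨root_mem_rootPolytope i, fun m hm => ?_⟩ hkA
    rw [Set.mem_ofPred_eq, hf, hf] at hi
    have := (Finset.sum_eq_sum_iff_of_le (hle i)).1 hi m (Finset.mem_univ _)
    simpa [hm] using this
  exact this hmem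

/-- Every standard face is the standard face of a linked set of simple roots. -/
theorem IsHighestRoot.exists_isLinked (hθ : IsHighestRoot b θ) (h : IsInvariant P)
    {Γ : Finset ι} (hΓ : Γ ⊆ b.support) : ∃ Γ' ⊆ b.support, IsLinked P θ Γ' ∧
      standardFace b θ Γ' = standardFace b θ Γ := by
  classical
  -- Remove the largest union of components orthogonal to `θ`; any violation of linkedness in what
  -- remains could be added to it.
  let good : Finset ι → Prop := fun A => A ⊆ Γ ∧
    (∀ i ∈ A, inner ℝ (P.root i) (P.root θ) = 0) ∧
    ∀ i ∈ A, ∀ j ∈ Γ, j ∉ A → inner ℝ (P.root i) (P.root j) = 0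
  have hne : (Γ.powerset.filter good).Nonempty :=
    ⟨∅, Finset.mem_filter.2 ⟨Finset.empty_mem_powerset _, Finset.empty_subset _, by simp, by simp⟩⟩
  obtain ⟨A, hA, hmax⟩ := Finset.exists_max_image _ Finset.card hne
  obtain ⟨hAΓ, hAθ, hAorth⟩ := (Finset.mem_filter.1 hA).2
  refine ⟨Γ \ A, Finset.sdiff_subset.trans hΓ, fun B hB hBθ hBorth => ?_,
    hθ.standardFace_sdiff h hΓ hAΓ hAθ hAorth⟩
  have hBΓ : ∀ i ∈ B, i ∈ Γ ∧ i ∉ A := fun i hi => Finset.mem_sdiff.1 (hB hi)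
  have hBfin : (B : Set ι).Finite := Set.toFinite B
  have hunion : good (A ∪ hBfin.toFinset) := by
    refine ⟨?_, ?_, ?_⟩
    · exact Finset.union_subset hAΓ fun i hi => (hBΓ i (hBfin.mem_toFinset.1 hi)).1
    · intro i hi
      rcases Finset.mem_union.1 hi with hi | hi
      exacts [hAθ i hi, hBθ i (hBfin.mem_toFinset.1 hi)]
    · intro i hi j hj hj'
      rw [Finset.mem_union, not_or, hBfin.mem_toFinset] at hj'
      rcases Finset.mem_union.1 hi with hi | hi
      · exact hAorth i hi j hj hj'.1
      · exact hBorth i (hBfin.mem_toFinset.1 hi) j (Finset.mem_sdiff.2 ⟨hj, hj'.1⟩) hj'.2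
  have hcard := hmax _ (Finset.mem_filter.2 ⟨Finset.mem_powerset.2 hunion.1, hunion⟩)
  have heq := Finset.eq_of_subset_of_card_le Finset.subset_union_left hcard
  refine Set.eq_empty_iff_forall_notMem.2 fun i hi => (hBΓ i hi).2 ?_
  rw [heq]
  exact Finset.mem_union_right _ (hBfin.mem_toFinset.2 hi)

-- Direction spaces, sums of roots and stabilizers

omit [Finite ι] [P.IsCrystallographic] [P.IsReduced] [P.IsIrreducible] in
theorem vectorSpan_standardFace_le (Γ : Finset ι) :
    vectorSpan ℝ (standardFace b θ Γ) ≤ Submodule.span ℝ (P.root '' Γ) := by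
  rw [vectorSpan_def, Submodule.span_le]
  rintro _ ⟨x, hx, y, hy, rfl⟩
  refine mem_span_of_coord_eq_zero (b := b) fun k hk => ?_
  change b.toWeightBasis.repr (x - y) k = 0
  rw [map_sub, Finsupp.sub_apply, hx.2 k hk, hy.2 k hk, sub_self]

omit [Finite ι] [P.IsCrystallographic] [P.IsReduced] [P.IsIrreducible] in
-- For a root `x` of the face, `x - s_i x` is a difference of roots of the face and a multiple of
-- `α_i`. If `α_i` is not in the span, it is therefore orthogonal to all these roots, `θ` among
-- them, and to every `α_j` in the span; linkedness excludes such `i`.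
theorem IsInvariant.root_mem_vectorSpan (h : IsInvariant P) {Γ : Finset ι} (hΓ : Γ ⊆ b.support)
    (hlink : IsLinked P θ Γ) {i : ι} (hi : i ∈ Γ) :
    P.root i ∈ vectorSpan ℝ (Set.range P.root ∩ standardFace b θ Γ) := by
  set V := vectorSpan ℝ (Set.range P.root ∩ standardFace b θ Γ) with hV
  have key : ∀ i ∈ Γ, P.root i ∉ V → ∀ x ∈ Set.range P.root ∩ standardFace b θ Γ,
      inner ℝ (P.root i) x = 0 := by
    rintro i hi hiV _ ⟨⟨j, rfl⟩, hj⟩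
    by_contra hne
    have hmem : P.root j - P.reflection i (P.root j) ∈ V :=
      vsub_mem_vectorSpan ℝ ⟨⟨j, rfl⟩, hj⟩
        ⟨⟨P.reflectionPerm i j, P.root_reflectionPerm i j⟩, h.reflection_mem_standardFace hΓ hi hj⟩
    rw [h.reflection_eq, sub_sub_cancel, Submodule.smul_mem_iff] at hmem
    · exact hiV hmem
    · rw [real_inner_comm] at hne
      exact div_ne_zero (mul_ne_zero two_ne_zero hne) (inner_root_self_pos i).ne'
  have hempty := hlink {i | i ∈ Γ ∧ P.root i ∉ V} (fun i hi => hi.1)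
    (fun i hi => key i hi.1 hi.2 _ ⟨⟨θ, rfl⟩, root_highest_mem_standardFace Γ⟩) (by
      rintro i ⟨hi, hiV⟩ j hj hj'
      have hjV : P.root j ∈ V := by
        by_contra hjV
        exact hj' ⟨hj, hjV⟩
      have hle : V ≤ LinearMap.ker (innerₛₗ ℝ (P.root i)) := by
        rw [hV, vectorSpan_def, Submodule.span_le]
        rintro _ ⟨x, hx, y, hy, rfl⟩
        change inner ℝ (P.root i) (x - y) = 0
        rw [inner_sub_right, key i hi hiV x hx, key i hi hiV y hy, sub_self]
      exact hle hjV)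
  by_contra hiV
  exact Set.eq_empty_iff_forall_notMem.1 hempty i ⟨hi, hiV⟩

omit [Finite ι] [P.IsCrystallographic] [P.IsReduced] [P.IsIrreducible] in
theorem IsInvariant.vectorSpan_standardFace (h : IsInvariant P) {Γ : Finset ι}
    (hΓ : Γ ⊆ b.support) (hlink : IsLinked P θ Γ) :
    vectorSpan ℝ (standardFace b θ Γ) = Submodule.span ℝ (P.root '' Γ) := by
  refine (vectorSpan_standardFace_le Γ).antisymm (Submodule.span_le.2 ?_)
  rintro _ ⟨i, hi, rfl⟩
  exact vectorSpan_mono ℝ Set.inter_subset_right (h.root_mem_vectorSpan hΓ hlink hi)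

omit [Finite ι] [P.IsCrystallographic] [P.IsReduced] [P.IsIrreducible] [P.IsRootSystem] in
theorem mem_gammaStar {Γ : Finset ι} {i : ι} : i ∈ gammaStar b θ Γ ↔ i ∈ Γ ∨ i ∈ b.support ∧
    inner ℝ (P.root θ) (P.root i) = 0 ∧ ∀ j ∈ Γ, inner ℝ (P.root j) (P.root i) = 0 := by
  simp [gammaStar, extended, affineForm]

omit [Finite ι] [P.IsCrystallographic] [P.IsReduced] [P.IsIrreducible] in
theorem inner_eq_zero_of_mem_standardFace {Γ : Finset ι} {i : ι}
    (hθi : inner ℝ (P.root θ) (P.root i) = 0) (hi : ∀ j ∈ Γ, inner ℝ (P.root j) (P.root i) = 0)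
    {x : E} (hx : x ∈ standardFace b θ Γ) : inner ℝ x (P.root i) = 0 := by
  rw [inner_eq_sub_sum (b := b) θ, hθi, zero_sub, neg_eq_zero]
  refine Finset.sum_eq_zero fun k _ => ?_
  by_cases hk : (k : ι) ∈ Γ
  · rw [hi k hk, mul_zero]
  · rw [hx.2 k hk, sub_self, zero_mul]

omit [Finite ι] [P.IsCrystallographic] [P.IsReduced] [P.IsIrreducible] in
-- Reflections in `Γ` alter only coordinates that the face leaves free; the remaining generators fix
-- the face pointwise.
theorem IsInvariant.parabolicSubgroup_le_stabilizer (h : IsInvariant P) {Γ : Finset ι}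
    (hΓ : Γ ⊆ b.support) : parabolicSubgroup P (gammaStar b θ Γ) ≤
      MulAction.stabilizer P.weylGroup (standardFace b θ Γ) := by
  rw [parabolicSubgroup, Subgroup.closure_le]
  rintro _ ⟨i, hi, rfl⟩
  have hmem : ∀ x ∈ standardFace b θ Γ, P.reflection i x ∈ standardFace b θ Γ := by
    intro x hx
    rcases mem_gammaStar.1 hi with hi | ⟨-, hiθ, hiΓ⟩
    · exact h.reflection_mem_standardFace hΓ hi hx
    · rwa [h.reflection_eq_self (inner_eq_zero_of_mem_standardFace hiθ hiΓ hx)]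
  refine Set.Subset.antisymm ?_ fun x hx => ⟨P.reflection i x, hmem x hx, ?_⟩
  · rintro _ ⟨x, hx, rfl⟩
    exact hmem x hx
  · exact P.reflection_same i x

theorem IsHighestRoot.inner_nonneg_of_mem (hθ : IsHighestRoot b θ) (h : IsInvariant P)
    {Γ : Finset ι} {i : ι} (hi : i ∈ b.support) (hiΓ : i ∉ Γ) {x : E}
    (hx : x ∈ standardFace b θ Γ) : 0 ≤ inner ℝ x (P.root i) := by
  rw [inner_eq_sub_sum (b := b) θ, sub_nonneg]
  refine (Finset.sum_nonpos fun k _ => ?_).trans (hθ.isDominant h i hi)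
  by_cases hk : (k : ι) = i
  · rw [hx.2 k (hk ▸ hiΓ), sub_self, zero_mul]
  · exact mul_nonpos_of_nonneg_of_nonpos (sub_nonneg.2 (hθ.coord_le_of_mem h hx.1 k))
      (h.inner_simple_nonpos k.2 hi hk)

omit [P.IsCrystallographic] [P.IsReduced] [P.IsIrreducible] in
theorem IsInvariant.inner_rootSum_eq_zero (h : IsInvariant P) {Γ : Finset ι}
    (hΓ : Γ ⊆ b.support) {i : ι} (hi : i ∈ Γ) :
    inner ℝ (rootSum P (standardFace b θ Γ)) (P.root i) = 0 := by
  have hmem : RootPairing.weylGroup.ofIdx P i ∈ parabolicSubgroup P (gammaStar b θ Γ) :=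
    Subgroup.subset_closure ⟨i, mem_gammaStar.2 (Or.inl hi), rfl⟩
  have h₁ := smul_rootSum (RootPairing.weylGroup.ofIdx P i) (standardFace b θ Γ)
  rw [MulAction.mem_stabilizer_iff.1 (h.parabolicSubgroup_le_stabilizer hΓ hmem),
    ofIdx_smul_vector] at h₁
  have h₂ := h.inner_reflection_self i (rootSum P (standardFace b θ Γ))
  rw [h₁] at h₂
  linarith

theorem IsHighestRoot.isDominant_rootSum (hθ : IsHighestRoot b θ) (h : IsInvariant P)
    {Γ : Finset ι} (hΓ : Γ ⊆ b.support) : IsDominant b (rootSum P (standardFace b θ Γ)) := by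
  intro i hi
  by_cases hiΓ : i ∈ Γ
  · exact (h.inner_rootSum_eq_zero hΓ hiΓ).ge
  · rw [rootSum, sum_inner]
    exact Finset.sum_nonneg fun j hj =>
      hθ.inner_nonneg_of_mem h hi hiΓ (mem_of_mem_toFinset hj)

/-- For `i ∉ Γ` each root of the face pairs nonnegatively with `α_i`, so a zero sum makes `α_i`
orthogonal to every root of the face, hence to `θ` and to the span of their differences, which
contains `Γ`. -/
theorem IsHighestRoot.zeros_rootSum (hθ : IsHighestRoot b θ) (h : IsInvariant P)
    {Γ : Finset ι} (hΓ : Γ ⊆ b.support) (hlink : IsLinked P θ Γ) :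
    {i | i ∈ b.support ∧ inner ℝ (rootSum P (standardFace b θ Γ)) (P.root i) = 0} =
      gammaStar b θ Γ := by
  ext i
  rw [Set.mem_ofPred_eq, mem_gammaStar]
  constructor
  · rintro ⟨hi, hzero⟩
    refine or_iff_not_imp_left.2 fun hiΓ => ⟨hi, ?_⟩
    rw [rootSum, sum_inner, Finset.sum_eq_zero_iff_of_nonneg fun j hj =>
      hθ.inner_nonneg_of_mem h hi hiΓ (mem_of_mem_toFinset hj)] at hzero
    have hzero' : ∀ x ∈ Set.range P.root ∩ standardFace b θ Γ, inner ℝ (P.root i) x = 0 := by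
      rintro _ ⟨⟨j, rfl⟩, hj⟩
      rw [real_inner_comm]
      exact hzero j ((Set.Finite.mem_toFinset (Set.toFinite {j | P.root j ∈ standardFace b θ Γ})).2 hj)
    refine ⟨?_, fun j hj => ?_⟩
    · rw [real_inner_comm]
      exact hzero' _ ⟨⟨θ, rfl⟩, root_highest_mem_standardFace Γ⟩
    · have hle : vectorSpan ℝ (Set.range P.root ∩ standardFace b θ Γ) ≤
          LinearMap.ker (innerₛₗ ℝ (P.root i)) := by
        rw [vectorSpan_def, Submodule.span_le]
        rintro _ ⟨x, hx, y, hy, rfl⟩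
        change inner ℝ (P.root i) (x - y) = 0
        rw [inner_sub_right, hzero' x hx, hzero' y hy, sub_self]
      rw [real_inner_comm]
      exact hle (h.root_mem_vectorSpan hΓ hlink hj)
  · rintro (hi | ⟨hi, hiθ, hiΓ⟩)
    · exact ⟨hΓ hi, h.inner_rootSum_eq_zero hΓ hi⟩
    · refine ⟨hi, ?_⟩
      rw [rootSum, sum_inner]
      exact Finset.sum_eq_zero fun j hj =>
        inner_eq_zero_of_mem_standardFace hiθ hiΓ (mem_of_mem_toFinset hj)

/-- `w` carries one dominant root sum to the other, so it lies in the parabolic subgroup `W⟨Γ*⟩`,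
which preserves the first face. The two faces coincide, and their direction space recovers the set
of simple roots. -/
theorem IsHighestRoot.smul_standardFace_eq (hθ : IsHighestRoot b θ) (h : IsInvariant P)
    {Γ Γ' : Finset ι} (hΓ : Γ ⊆ b.support) (hlink : IsLinked P θ Γ) (hΓ' : Γ' ⊆ b.support)
    (hlink' : IsLinked P θ Γ') {w : P.weylGroup}
    (hw : w • standardFace b θ Γ = standardFace b θ Γ') :
    Γ = Γ' ∧ w ∈ parabolicSubgroup P (gammaStar b θ Γ) := by
  have hsum := smul_rootSum w (standardFace b θ Γ)
  rw [hw] at hsum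
  have hpar := (h.smul_dominant w (hθ.isDominant_rootSum h hΓ) (hθ.isDominant_rootSum h hΓ')
    hsum).2
  rw [hθ.zeros_rootSum h hΓ hlink] at hpar
  refine ⟨?_, hpar⟩
  have hface : standardFace b θ Γ = standardFace b θ Γ' := by
    rw [← hw, MulAction.mem_stabilizer_iff.1 (h.parabolicSubgroup_le_stabilizer hΓ hpar)]
  have hspan : Submodule.span ℝ (P.root '' Γ) = Submodule.span ℝ (P.root '' Γ') := by
    rw [← h.vectorSpan_standardFace hΓ hlink, ← h.vectorSpan_standardFace hΓ' hlink', hface]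
  have hmem : ∀ S : Finset ι, S ⊆ b.support → ∀ i ∈ b.support,
      (P.root i ∈ Submodule.span ℝ (P.root '' S) ↔ i ∈ S) := fun S hS i hi =>
    (b.linearIndepOn_root.mono (Finset.coe_subset.2 hS)).mem_span_iff.trans
      ⟨fun hins => hins (b.linearIndepOn_root.mono
        (Set.insert_subset hi (Finset.coe_subset.2 hS))), fun hiS _ => hiS⟩
  ext i
  exact ⟨fun hi => (hmem Γ' hΓ' i (hΓ hi)).1 (hspan ▸ (hmem Γ hΓ i (hΓ hi)).2 hi),
    fun hi => (hmem Γ hΓ i (hΓ' hi)).1 (hspan ▸ (hmem Γ' hΓ' i (hΓ' hi)).2 hi)⟩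

theorem IsHighestRoot.stabilizer_standardFace (hθ : IsHighestRoot b θ) (h : IsInvariant P)
    {Γ : Finset ι} (hΓ : Γ ⊆ b.support) (hlink : IsLinked P θ Γ) :
    MulAction.stabilizer P.weylGroup (standardFace b θ Γ) =
      parabolicSubgroup P (gammaStar b θ Γ) :=
  le_antisymm (fun _ hw => (hθ.smul_standardFace_eq h hΓ hlink hΓ hlink hw).2)
    (h.parabolicSubgroup_le_stabilizer hΓ)

end Faces

-- Classification and counting of faces

section FaceCount

variable {ι E N : Type*} [Finite ι] [NormedAddCommGroup E] [InnerProductSpace ℝ E]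
  [AddCommGroup N] [Module ℝ N] {P : RootPairing ι ℝ E N} [P.IsRootSystem] [P.IsCrystallographic]
  [P.IsReduced] [P.IsIrreducible] {b : P.Base} {θ : ι}

open Classical in
-- `f θ - f x` is a sum of nonnegative terms, one per simple root; it vanishes iff each coordinate
-- with `f α_k ≠ 0` agrees with that of `θ`.
theorem IsHighestRoot.maximizers_eq_standardFace (hθ : IsHighestRoot b θ) (h : IsInvariant P)
    (f : E →ₗ[ℝ] ℝ) (hf : ∀ i ∈ b.support, 0 ≤ f (P.root i)) :
    {x | x ∈ rootPolytope P ∧ ∀ y ∈ rootPolytope P, f y ≤ f x} =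
      standardFace b θ (b.support.filter fun i => f (P.root i) = 0) := by
  have hsum : ∀ x, f (P.root θ) - f x = ∑ k : b.support,
      (b.toWeightBasis.repr (P.root θ) k - b.toWeightBasis.repr x k) * f (P.root k) := by
    intro x
    rw [← map_sub, ← b.toWeightBasis.sum_repr (P.root θ - x), map_sum]
    simp
  have hnn : ∀ x ∈ rootPolytope P, ∀ k ∈ (Finset.univ : Finset b.support),
      0 ≤ (b.toWeightBasis.repr (P.root θ) k - b.toWeightBasis.repr x k) * f (P.root k) :=
    fun x hx k _ => mul_nonneg (sub_nonneg.2 (hθ.coord_le_of_mem h hx k)) (hf k k.2)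
  have hle : ∀ x ∈ rootPolytope P, f x ≤ f (P.root θ) := by
    intro x hx
    rw [← sub_nonneg, hsum]
    exact Finset.sum_nonneg (hnn x hx)
  ext x
  constructor
  · rintro ⟨hx, hmax⟩
    refine ⟨hx, fun k hk => ?_⟩
    have hzero : f (P.root θ) - f x = 0 :=
      sub_eq_zero.2 ((hmax _ (root_mem_rootPolytope θ)).antisymm (hle x hx))
    rw [hsum, Finset.sum_eq_zero_iff_of_nonneg (hnn x hx)] at hzero
    have hk' : f (P.root k) ≠ 0 := fun h0 => hk (Finset.mem_filter.2 ⟨k.2, h0⟩)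
    linarith [(mul_eq_zero.1 (hzero k (Finset.mem_univ _))).resolve_right hk']
  · rintro ⟨hx, hcoord⟩
    refine ⟨hx, fun y hy => (hle y hy).trans (sub_nonpos.1 (le_of_eq ?_))⟩
    rw [hsum]
    refine Finset.sum_eq_zero fun k _ => ?_
    by_cases hk : f (P.root k) = 0
    · rw [hk, mul_zero]
    · rw [hcoord k fun hmem => hk (Finset.mem_filter.1 hmem).2, sub_self, zero_mul]

omit [Finite ι] [P.IsCrystallographic] [P.IsReduced] [P.IsIrreducible] in
theorem finiteDimensional_of_base (b : P.Base) : FiniteDimensional ℝ E :=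
  Module.Finite.of_basis b.toWeightBasis

theorem IsHighestRoot.exists_smul_standardFace_eq (hθ : IsHighestRoot b θ) (h : IsInvariant P)
    {F : Set E} (hF : F.Nonempty) (hexp : IsExposed ℝ (rootPolytope P) F) :
    ∃ Γ ⊆ b.support, IsLinked P θ Γ ∧ ∃ w : P.weylGroup, w • standardFace b θ Γ = F := by
  have := finiteDimensional_of_base b
  have := FiniteDimensional.complete ℝ E
  -- The exposing functional is represented by a vector `v`, which some `w` makes dominant; then `w
  -- • F` is a standard face.
  obtain ⟨l, hl⟩ := hexp hF
  set v := (InnerProductSpace.toDual ℝ E).symm l with hv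
  have hlv : ∀ x, l x = inner ℝ v x := fun x => (InnerProductSpace.toDual_symm_apply).symm
  obtain ⟨w, hw⟩ := h.exists_isDominant_smul b v
  have hmax := hθ.maximizers_eq_standardFace h (innerₛₗ ℝ (w • v)) hw
  have hFw : w • F = {x | x ∈ rootPolytope P ∧ ∀ y ∈ rootPolytope P,
      innerₛₗ ℝ (w • v) y ≤ innerₛₗ ℝ (w • v) x} := by
    have hinner : ∀ x, l (w⁻¹ • x) = inner ℝ (w • v) x := by
      intro x
      rw [hlv, ← h.inner_smul_smul w, smul_inv_smul]
    ext x
    rw [Set.mem_smul_set_iff_inv_smul_mem, hl]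
    refine and_congr ?_ ⟨fun hx y hy => ?_, fun hx y hy => ?_⟩
    · exact ⟨fun hx => by simpa using smul_mem_rootPolytope w hx, smul_mem_rootPolytope w⁻¹⟩
    · have := hx _ (smul_mem_rootPolytope w⁻¹ hy)
      rwa [hinner, hinner] at this
    · have := hx _ (smul_mem_rootPolytope w hy)
      change inner ℝ (w • v) (w • y) ≤ inner ℝ (w • v) x at this
      rwa [← hinner, ← hinner, inv_smul_smul] at this
  rw [hmax] at hFw
  classical
  obtain ⟨Γ, hΓ, hlink, hface⟩ := hθ.exists_isLinked h
    (Γ := b.support.filter fun i => innerₛₗ ℝ (w • v) (P.root i) = 0) (Finset.filter_subset _ _)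
  refine ⟨Γ, hΓ, hlink, w⁻¹, ?_⟩
  rw [hface, ← hFw, inv_smul_smul]

theorem IsHighestRoot.isExposed_smul_standardFace (hθ : IsHighestRoot b θ) (h : IsInvariant P)
    {Γ : Finset ι} (hΓ : Γ ⊆ b.support) (w : P.weylGroup) :
    IsExposed ℝ (rootPolytope P) (w • standardFace b θ Γ) := by
  classical
  have := finiteDimensional_of_base b
  intro _
  -- Nonnegative on simple roots and zero exactly on those in `Γ`; composing with `w⁻¹` exposes the
  -- translate.
  let f : E →ₗ[ℝ] ℝ := ∑ m : b.support, if (m : ι) ∈ Γ then 0 else b.toWeightBasis.coord m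
  have hf : ∀ i : b.support, f (P.root i) = if (i : ι) ∈ Γ then 0 else 1 := by
    intro i
    simp only [f, LinearMap.sum_apply]
    rw [Finset.sum_eq_single i]
    · split_ifs <;> simp
    · intro j _ hj
      split_ifs
      · rfl
      · simp [hj]
    · simp
  have hmax := hθ.maximizers_eq_standardFace h f (fun i hi => by
    rw [hf ⟨i, hi⟩]
    split_ifs <;> norm_num)
  have hfilter : (b.support.filter fun i => f (P.root i) = 0) = Γ := by
    ext i
    rw [Finset.mem_filter]
    constructor
    · rintro ⟨hi, h0⟩
      by_contra hiΓ
      rw [hf ⟨i, hi⟩, if_neg hiΓ] at h0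
      exact one_ne_zero h0
    · exact fun hi => ⟨hΓ hi, by rw [hf ⟨i, hΓ hi⟩, if_pos hi]⟩
  rw [hfilter] at hmax
  refine ⟨LinearMap.toContinuousLinearMap
    (f ∘ₗ (RootPairing.Equiv.weightHom P (w⁻¹ : P.weylGroup) : E →ₗ[ℝ] E)), ?_⟩
  ext x
  rw [Set.mem_smul_set_iff_inv_smul_mem, ← hmax]
  refine and_congr ?_ ⟨fun hx y hy => hx _ (smul_mem_rootPolytope w⁻¹ hy), fun hx y hy => ?_⟩
  · exact ⟨fun hx => by simpa using smul_mem_rootPolytope w hx, smul_mem_rootPolytope w⁻¹⟩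
  · have := hx _ (smul_mem_rootPolytope w hy)
    change f (w⁻¹ • w • y) ≤ f (w⁻¹ • x) at this
    rwa [inv_smul_smul] at this

omit [Finite ι] [P.IsRootSystem] [P.IsCrystallographic] [P.IsReduced] [P.IsIrreducible] in
theorem finrank_vectorSpan_smul (w : P.weylGroup) (F : Set E) :
    Module.finrank ℝ (vectorSpan ℝ (w • F)) = Module.finrank ℝ (vectorSpan ℝ F) := by
  have : vectorSpan ℝ (w • F) =
      (vectorSpan ℝ F).map (RootPairing.Equiv.weightHom P w : E →ₗ[ℝ] E) :=
    ((RootPairing.Equiv.weightHom P w :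
      E →ₗ[ℝ] E).toAffineMap.map_vectorSpan).symm
  rw [this]
  exact LinearEquiv.finrank_map_eq (RootPairing.Equiv.weightHom P (w : RootPairing.Aut P)) _

omit [Finite ι] [P.IsCrystallographic] [P.IsReduced] [P.IsIrreducible] in
theorem IsInvariant.finrank_vectorSpan_smul_standardFace (h : IsInvariant P) {Γ : Finset ι}
    (hΓ : Γ ⊆ b.support) (hlink : IsLinked P θ Γ) (w : P.weylGroup) :
    Module.finrank ℝ (vectorSpan ℝ (w • standardFace b θ Γ)) = Γ.card := by
  rw [finrank_vectorSpan_smul, h.vectorSpan_standardFace hΓ hlink]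
  have hind := b.linearIndepOn_root.mono (Finset.coe_subset.2 hΓ)
  have := finrank_span_eq_card hind
  rw [Set.image_eq_range]
  simpa using this

theorem IsHighestRoot.facesOfDim_eq (hθ : IsHighestRoot b θ) (h : IsInvariant P) (d : ℕ) :
    facesOfDim (rootPolytope P) d =
      ⋃ Γ ∈ (irreducibleFamily b θ).filter fun Γ => Γ.card = d,
        MulAction.orbit P.weylGroup (standardFace b θ Γ) := by
  ext F
  simp only [Set.mem_iUnion, Finset.mem_filter, h.mem_irreducibleFamily, exists_prop]
  constructor
  · rintro ⟨hne, hexp, hdim⟩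
    obtain ⟨Γ, hΓ, hlink, w, rfl⟩ := hθ.exists_smul_standardFace_eq h hne hexp
    rw [h.finrank_vectorSpan_smul_standardFace hΓ hlink] at hdim
    exact ⟨Γ, ⟨⟨hΓ, hlink⟩, hdim⟩, w, rfl⟩
  · rintro ⟨Γ, ⟨⟨hΓ, hlink⟩, hdim⟩, w, rfl⟩
    exact ⟨Set.Nonempty.smul_set ⟨_, root_highest_mem_standardFace Γ⟩,
      hθ.isExposed_smul_standardFace h hΓ w,
      (h.finrank_vectorSpan_smul_standardFace hΓ hlink w).trans hdim⟩

theorem IsHighestRoot.ncard_facesOfDim (hθ : IsHighestRoot b θ) (h : IsInvariant P) (d : ℕ) :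
    (facesOfDim (rootPolytope P) d).ncard =
      ∑ Γ ∈ (irreducibleFamily b θ).filter fun Γ => Γ.card = d,
        (parabolicSubgroup P (gammaStar b θ Γ)).index := by
  have := finite_weylGroup (P := P)
  set S := (irreducibleFamily b θ).filter fun Γ => Γ.card = d with hS
  have hmem : ∀ Γ ∈ S, Γ ⊆ b.support ∧ IsLinked P θ Γ := fun Γ hΓ =>
    h.mem_irreducibleFamily.1 (Finset.mem_filter.1 hΓ).1
  have hdisj : (S : Set (Finset ι)).PairwiseDisjoint
      fun Γ => MulAction.orbit P.weylGroup (standardFace b θ Γ) := by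
    intro Γ hΓ Γ' hΓ' hne
    obtain ⟨hΓ, hlink⟩ := hmem Γ hΓ
    obtain ⟨hΓ', hlink'⟩ := hmem Γ' hΓ'
    refine Set.disjoint_left.2 ?_
    rintro _ ⟨w, rfl⟩ ⟨w', hw'⟩
    refine hne (hθ.smul_standardFace_eq h hΓ hlink hΓ' hlink' (w := w'⁻¹ * w) ?_).1
    rw [mul_smul, inv_smul_eq_iff]
    exact hw'.symm
  have hcard := S.finite_toSet.ncard_biUnion (fun Γ _ => Set.finite_range _) hdisj
  rw [finsum_mem_coe_finset] at hcard
  rw [hθ.facesOfDim_eq h]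
  refine hcard.trans (Finset.sum_congr rfl fun Γ hΓ => ?_)
  obtain ⟨hΓ, hlink⟩ := hmem Γ hΓ
  rw [← hθ.stabilizer_standardFace h hΓ hlink, MulAction.index_stabilizer]
  rfl

theorem IsHighestRoot.fPolynomial_rootPolytope (hθ : IsHighestRoot b θ) (h : IsInvariant P) :
    fPolynomial (rootPolytope P) = ∑ Γ ∈ irreducibleFamily b θ,
      C (parabolicSubgroup P (gammaStar b θ Γ)).index * X ^ Γ.card := by
  -- Group the sets `Γ` by cardinality, which is at most the number of simple roots, the dimension
  -- of `E`.
  rw [fPolynomial, ← Finset.sum_fiberwise_of_maps_to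
    (t := Finset.range (Module.finrank ℝ E + 1)) (g := Finset.card)]
  · refine Finset.sum_congr rfl fun d _ => ?_
    rw [hθ.ncard_facesOfDim h, map_sum, Finset.sum_mul]
    exact Finset.sum_congr rfl fun Γ hΓ => by rw [(Finset.mem_filter.1 hΓ).2]
  · intro Γ hΓ
    rw [Finset.mem_range, Nat.lt_succ_iff, Module.finrank_eq_card_basis b.toWeightBasis,
      Fintype.card_coe]
    exact Finset.card_le_card (h.mem_irreducibleFamily.1 hΓ).1

end FaceCount

end RootPolytope

theorem corollary5p6 {ι E N : Type*} [Finite ι]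
    [NormedAddCommGroup E] [InnerProductSpace ℝ E] [AddCommGroup N] [Module ℝ N]
    (P : RootPairing ι ℝ E N) [P.IsRootSystem] [P.IsCrystallographic] [P.IsReduced]
    [P.IsIrreducible]
    (hinv : ∀ (i : ι) (x y : E), inner ℝ (P.reflection i x) (P.reflection i y) = inner ℝ x y)
    (b : P.Base) (θ : ι) (hθ : RootPolytope.IsHighestRoot b θ) :
    RootPolytope.fPolynomial (RootPolytope.rootPolytope P) =
        ∑ Γ ∈ RootPolytope.irreducibleFamily b θ,
          Polynomial.C (RootPolytope.parabolicSubgroup P (RootPolytope.gammaStar b θ Γ)).index *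
            Polynomial.X ^ Γ.card ∧
      ∀ Γ ∈ RootPolytope.irreducibleFamily b θ, ∀ w : P.weylGroup,
        (fun x : E => w • x) '' RootPolytope.standardFace b θ Γ = RootPolytope.standardFace b θ Γ ↔
          w ∈ RootPolytope.parabolicSubgroup P (RootPolytope.gammaStar b θ Γ) := by
  have h : RootPolytope.IsInvariant P := hinv
  refine ⟨hθ.fPolynomial_rootPolytope h, fun Γ hΓ w => ?_⟩
  obtain ⟨hΓ, hlink⟩ := h.mem_irreducibleFamily.1 hΓ
  rw [← hθ.stabilizer_standardFace h hΓ hlink]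
  exact Iff.rfl
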